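/- Let $n\ge 2$, let $a\ge 2$, $b\ge 0$ be integers with $a+b\le n$, and let $B$ be a bilinear form on $\mathbb{C}^n$. Put $$Q(z,\bar z)=\sum_{j=1}^{a}|z_j|^2-\sum_{j=a+1}^{a+b}|z_j|^2+B(z,z)+\overline{B(z,z)},$$ and assume that the real quadratic form $Q$ is nondegenerate, that is, it is represented by a nonsingular real symmetric $2n\times 2n$ matrix. For a smooth real-valued function $\rho$ on an open set $U\subset\mathbb{C}^n$, let $M=\{(z,\rho(z,\bar z)) : z\in U\}\subset\mathbb{C}^n\times\mathbb{R}$, and for $p\in M$ let $T^{(0,1)}_pM=(\mathbb{C}\otimes T_pM)\cap\operatorname{span}_{\mathbb{C}}\{\partial/\partial\bar z_1,\dots,\partial/\partial\bar z_n\}$. Let $M_{CR}$ be the set of $p\in M$ with $\dim_{\mathbb{C}}T^{(0,1)}_pM=n-1$. A smooth function $f\colon M\to\mathbb{C}$ is CR on $M_{CR}$ if $vf=0$ for every $p\in M_{CR}$ and every $v\in T^{(0,1)}_pM$. Functions on $M$ are written as functions $f(z,\bar z)$ of the parameter $z$. (1) Let $M^{quad}$ be given by $s=Q(z,\bar z)$,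 $z\in\mathbb{C}^n$, and let $f(z,\bar z)$ be a polynomial which, as a function on $M^{quad}$ parametrized by $z$, is CR on $(M^{quad})_{CR}$. Then there is a polynomial $F(z,s)$ with $$f(z,\bar z)=F\bigl(z,Q(z,\bar z)\bigr)\quad\text{for all } z\in\mathbb{C}^n.$$ Furthermore, if $f$ is homogeneous of degree $d$ in $(z,\bar z)$, then $F$ is weighted homogeneous of degree $d$, that is, $F(z,s)=\sum_{j+2k=d}P_j(z)s^k$ with $P_j$ a homogeneous polynomial of degree $j$. (2) Let $U\subset\mathbb{C}^n$ be an open neighborhood of $0$, let $E\colon U\to\mathbb{R}$ be smooth with $E=O(\|z\|^3)$ at $0$, put $\rho=Q+E$, and let $M$ be given by $s=\rho(z,\bar z)$, $z\in U$. Let $f\in C^\infty(M)$ be CR on $M_{CR}$. Then there is a formal power series $F(z,s)$ with complex coefficients such that $$F\bigl(z,\rho(z,\bar z)\bigr)=f(z,\bar z)\quad\text{formally at } 0,$$ that is, substituting the Taylor series of $\rho$ at $0$ in $(z,\bar z)$ for $s$ in $F(z,s)$ gives the Taylor series of $f$ at $0$ in $(z,\bar z)$. -/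

import Mathlib

open scoped TensorProduct ComplexConjugate ContDiff Nat Topology

noncomputable section

namespace CRSing

/-- The function
`Q(z, z̄) = ∑_{j ≤ a} |z_j|² - ∑_{a < j ≤ a + b} |z_j|² + B(z, z) + conj (B(z, z))` on `ℂⁿ`,
where `B` is a complex bilinear form (the indices of `Fin n` start at `0`). -/
def quadFun {n : ℕ} (a b : ℕ) (B : LinearMap.BilinForm ℂ (Fin n → ℂ)) (z : Fin n → ℂ) : ℝ :=
  ∑ j : Fin n with j.val < a, ‖z j‖ ^ 2
    - ∑ j : Fin n with a ≤ j.val ∧ j.val < a + b, ‖z j‖ ^ 2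
    + (B z z + conj (B z z)).re

theorem polar_quadFun {n : ℕ} (a b : ℕ) (B : LinearMap.BilinForm ℂ (Fin n → ℂ))
    (x y : Fin n → ℂ) :
    QuadraticMap.polar (quadFun a b B) x y =
      ∑ j : Fin n with j.val < a, 2 * (x j * conj (y j)).re
        - ∑ j : Fin n with a ≤ j.val ∧ j.val < a + b, 2 * (x j * conj (y j)).re
        + 2 * (B x y + B y x).re := by
  have h : ∀ u v : ℂ, 2 * (u * conj v).re = ‖u + v‖ ^ 2 - ‖u‖ ^ 2 - ‖v‖ ^ 2 := by
    intro u v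
    simp only [Complex.sq_norm, Complex.normSq_apply, Complex.mul_re, Complex.conj_re,
      Complex.conj_im, Complex.add_re, Complex.add_im]
    ring
  simp only [QuadraticMap.polar, quadFun, h, Finset.sum_sub_distrib, map_add,
    LinearMap.add_apply, Complex.add_re, Complex.conj_re, Pi.add_apply]
  ring

/-- `quadFun` as a real quadratic form. -/
def quadForm {n : ℕ} (a b : ℕ) (B : LinearMap.BilinForm ℂ (Fin n → ℂ)) :
    QuadraticForm ℝ (Fin n → ℂ) :=
  QuadraticMap.ofPolar (quadFun a b B)
    (by
      intro r x
      have hr : r • x = (r : ℂ) • x := by ext i; simp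
      have h1 : ∀ j, ‖(r • x) j‖ ^ 2 = r * r * ‖x j‖ ^ 2 := by
        intro j
        rw [Pi.smul_apply, norm_smul, mul_pow, Real.norm_eq_abs, sq_abs, sq r]
      have h2 : B (r • x) (r • x) = ((r * r : ℝ) : ℂ) * B x x := by
        rw [hr]
        simp only [map_smul, LinearMap.smul_apply, smul_eq_mul]
        push_cast
        ring
      simp only [quadFun, h1, h2, ← Finset.mul_sum, Complex.add_re, Complex.conj_re,
        Complex.re_ofReal_mul, smul_eq_mul]
      ring)
    (by
      intro x x' y
      simp only [polar_quadFun, Pi.add_apply, add_mul, Complex.add_re, mul_add,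
        Finset.sum_add_distrib, map_add, LinearMap.add_apply]
      ring)
    (by
      intro r x y
      have hr : r • x = (r : ℂ) • x := by ext i; simp
      have h1 : ∀ j, 2 * (((r : ℂ) • x) j * conj (y j)).re = r * (2 * (x j * conj (y j)).re) := by
        intro j
        rw [Pi.smul_apply, smul_eq_mul, mul_assoc, Complex.re_ofReal_mul]
        ring
      rw [hr]
      simp only [polar_quadFun, h1, ← Finset.mul_sum, map_smul, LinearMap.smul_apply, smul_eq_mul,
        Complex.add_re, Complex.re_ofReal_mul]
      ring)

/-- A real quadratic form is nondegenerate if its symmetric bilinear form is nondegenerate, i.e.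
if the symmetric `2n × 2n` matrix representing it is nonsingular. -/
def QuadNondegenerate {n : ℕ} (Q : QuadraticForm ℝ (Fin n → ℂ)) : Prop :=
  (QuadraticMap.associated Q).Nondegenerate

/-- The real tangent space at `(z, ρ z)` of the graph `M : s = ρ z` in `ℂⁿ × ℝ`. -/
def graphTangent {n : ℕ} (ρ : (Fin n → ℂ) → ℝ) (z : Fin n → ℂ) :
    Submodule ℝ ((Fin n → ℂ) × ℝ) :=
  LinearMap.range (fderiv ℝ (fun w => (w, ρ w)) z).toLinearMap

/-- The vector `∂/∂z̄_j = (∂/∂x_j + i ∂/∂y_j) / 2` in the complexified tangent space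
`ℂ ⊗ (ℂⁿ × ℝ)` of `ℂⁿ × ℝ`. -/
def dzbarVec {n : ℕ} (j : Fin n) : ℂ ⊗[ℝ] ((Fin n → ℂ) × ℝ) :=
  (1 / 2 : ℂ) ⊗ₜ[ℝ] ((Pi.single j 1, 0) : (Fin n → ℂ) × ℝ)
    + (Complex.I / 2) ⊗ₜ[ℝ] ((Pi.single j Complex.I, 0) : (Fin n → ℂ) × ℝ)

/-- `T^{(0,1)}_p M = (ℂ ⊗ T_p M) ∩ span {∂/∂z̄_1, …, ∂/∂z̄_n}` at `p = (z, ρ z)`. -/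
def T01 {n : ℕ} (ρ : (Fin n → ℂ) → ℝ) (z : Fin n → ℂ) :
    Submodule ℂ (ℂ ⊗[ℝ] ((Fin n → ℂ) × ℝ)) :=
  (graphTangent ρ z).baseChange ℂ ⊓ Submodule.span ℂ (Set.range dzbarVec)

/-- `(z, ρ z)` is a CR point of `M`: the CR dimension there is `n - 1`. -/
def IsCRPoint {n : ℕ} (ρ : (Fin n → ℂ) → ℝ) (z : Fin n → ℂ) : Prop :=
  Module.finrank ℂ (T01 ρ z) + 1 = n

/-- The derivative `v f` of a function on `M` along a complex tangent vector `v ∈ ℂ ⊗ T_p M`,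
`p = (z, ρ z)`, where `f` is written in the parametrization of `M` by `z`. In that parametrization
the tangent vector `(u, dρ u)` of `M` is `u`, so `v f` is the complex linear extension of
`(u, t) ↦ df_z u`. -/
def vecDeriv {n : ℕ} (f : (Fin n → ℂ) → ℂ) (z : Fin n → ℂ) :
    ℂ ⊗[ℝ] ((Fin n → ℂ) × ℝ) →ₗ[ℂ] ℂ :=
  LinearMap.liftBaseChange ℂ
    ((fderiv ℝ f z).toLinearMap ∘ₗ LinearMap.fst ℝ (Fin n → ℂ) ℝ)

/-- `f`, as a function on `M = {(z, ρ z) : z ∈ U}` parametrized by `z`, is a CR function: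
`v f = 0` at every CR point of `M`, for every vector `v` of type `(0,1)` tangent to `M`. -/
def IsCRFunction {n : ℕ} (ρ : (Fin n → ℂ) → ℝ) (U : Set (Fin n → ℂ))
    (f : (Fin n → ℂ) → ℂ) : Prop :=
  ∀ z ∈ U, IsCRPoint ρ z → ∀ v ∈ T01 ρ z, vecDeriv f z v = 0

/-- The function `∂f/∂z_j = (∂f/∂x_j - i ∂f/∂y_j) / 2`. -/
def dz {n : ℕ} (j : Fin n) (f : (Fin n → ℂ) → ℂ) : (Fin n → ℂ) → ℂ := fun z =>
  (fderiv ℝ f z (Pi.single j 1) - Complex.I * fderiv ℝ f z (Pi.single j Complex.I)) / 2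

/-- The function `∂f/∂z̄_j = (∂f/∂x_j + i ∂f/∂y_j) / 2`. -/
def dzbar {n : ℕ} (j : Fin n) (f : (Fin n → ℂ) → ℂ) : (Fin n → ℂ) → ℂ := fun z =>
  (fderiv ℝ f z (Pi.single j 1) + Complex.I * fderiv ℝ f z (Pi.single j Complex.I)) / 2

/-- The iterated derivative `∂^{α + β} f / ∂z^α ∂z̄^β`, where the exponents of the variables
`z_j` (indices `Sum.inl j`) and `z̄_j` (indices `Sum.inr j`) are given by `m`. -/
def iterWirtinger {n : ℕ} (m : Fin n ⊕ Fin n →₀ ℕ) (f : (Fin n → ℂ) → ℂ) : (Fin n → ℂ) → ℂ :=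
  (List.finRange n).foldr (fun j g => (dz j)^[m (Sum.inl j)] g)
    ((List.finRange n).foldr (fun j g => (dzbar j)^[m (Sum.inr j)] g) f)

/-- The formal Taylor series at `0` of a smooth function, a power series in `z` (variables
`Sum.inl j`) and `z̄` (variables `Sum.inr j`): the coefficient of `z^α z̄^β` is
`∂^{α + β} f / ∂z^α ∂z̄^β (0) / (α! β!)`. -/
def taylorSeries {n : ℕ} (f : (Fin n → ℂ) → ℂ) : MvPowerSeries (Fin n ⊕ Fin n) ℂ := fun m =>
  iterWirtinger m f 0 / ((∏ i, (m i)! : ℕ) : ℂ)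

/-- The substitution `z = z`, `s = ρ(z, z̄)`, with `ρ` replaced by its formal Taylor series at `0`,
for power series in `z` (variables `Sum.inl j`) and `s` (variable `Sum.inr ()`). -/
def graphSubst {n : ℕ} (ρ : (Fin n → ℂ) → ℝ) :
    Fin n ⊕ Unit → MvPowerSeries (Fin n ⊕ Fin n) ℂ :=
  Sum.elim (fun j => MvPowerSeries.X (Sum.inl j)) (fun _ => taylorSeries (fun z => (ρ z : ℂ)))

/-- `F(z, ρ(z, z̄)) = f(z, z̄)` formally at the origin; the first conjunct says that `ρ(z, z̄)` may
be substituted for `s` in formal power series. -/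
def FormallyExtends {n : ℕ} (ρ : (Fin n → ℂ) → ℝ) (f : (Fin n → ℂ) → ℂ)
    (F : MvPowerSeries (Fin n ⊕ Unit) ℂ) : Prop :=
  MvPowerSeries.HasSubst (graphSubst ρ) ∧
    MvPowerSeries.subst (graphSubst ρ) F = taylorSeries f

end CRSing

end

/-! ### Polynomials whose gradient in `w` is parallel to that of `Q` -/

noncomputable section

namespace CRSing

open MvPolynomial (aeval pderiv X C monomial)

/-! Treat `z̄` as a second set of variables `w`. A vector `∑ c_j ∂/∂z̄_j` is tangent to the graph of
`ρ` exactly when `∑ c_j ∂ρ/∂z̄_j = 0`. Hence at a CR point the `z̄`-gradient of a CR function is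
parallel to that of `ρ`. Elsewhere the gradient of `ρ` vanishes, so the identities `ρ_i f_l = ρ_l
f_i` hold at every point. Taylor expansion at `0` is a ring homomorphism commuting with the
derivations, so they become identities of power series in `(z, w)` (`IsCRFunction.isParallel`).

Since `a ≥ 2`, the forms `Q_1 = z_1 + ℓ_1(w)` and `Q_2 = z_2 + ℓ_2(w)`, where `Q_j = ∂Q/∂w_j`, are
linear and not proportional; so `Q_1` is prime and does not divide `Q_2`
(`quadPoly_prime_and_not_dvd`). For a polynomial `f`, the relation `Q_1 f_2 = Q_2 f_1` forces `f_1 =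
g Q_1`, and then `f_i = g Q_i` for all `i`. Differentiating once more shows that the gradient of `g`
is again parallel to that of `Q`. The degree of `g` is smaller, so `g = G(z, Q)` by induction. If
`∂H/∂s = G`, then `f - H(z, Q)` has no `w`-gradient and is a polynomial in `z`
(`exists_aeval_eq_of_pderiv_parallel`). As `Q` is quadratic, weighted components of `F` match
homogeneous components of `f`.

For `ρ = Q + O(3)`, the lowest order part of `f` satisfies the relations for `Q`, so it is `F_d(z,
Q)` with `F_d` of weight `d`. Subtracting `F_d(z, ρ)` keeps the relations for `ρ` and raises the
order; iterating gives the formal series (`exists_subst_eq_of_isParallel`). -/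

theorem exists_pderiv_eq {σ K : Type*} [Field K] [CharZero K] (i : σ) (G : MvPolynomial σ K) :
    ∃ H, pderiv i H = G := by
  classical
  induction G using MvPolynomial.induction_on' with
  | monomial m c =>
    refine ⟨monomial (m + Finsupp.single i 1) (c / (m i + 1)), ?_⟩
    have h : (m i + 1 : K) ≠ 0 := by exact_mod_cast Nat.succ_ne_zero (m i)
    rw [MvPolynomial.pderiv_monomial]
    simp [div_mul_cancel₀ _ h]
  | add p q hp hq =>
    obtain ⟨P, rfl⟩ := hp
    obtain ⟨Q, rfl⟩ := hq
    exact ⟨P + Q, map_add _ _ _⟩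

/-- Chain rule for a derivation killing the variables `z`, applied to `H(z, s)`. -/
theorem derivation_aeval_sumElim {ι K A : Type*} [Field K] [CommRing A] [Algebra K A]
    (D : Derivation K A A) (x : ι → A) (hx : ∀ j, D (x j) = 0) (s : A)
    (H : MvPolynomial (ι ⊕ Unit) K) :
    D (aeval (Sum.elim x fun _ => s) H)
      = aeval (Sum.elim x fun _ => s) (pderiv (Sum.inr ()) H) * D s := by
  induction H using MvPolynomial.induction_on with
  | C c => simp
  | add p q hp hq => simp [hp, hq, add_mul]
  | mul_X p i hp =>
    rcases i with i | i
    · simp [hp, hx, MvPolynomial.pderiv_X_of_ne]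
      ring
    · simp [hp]
      ring

/-- In characteristic zero a monomial containing `w_k` has a nonzero `w_k`-derivative, and distinct
such monomials have distinct derivatives, so nothing can cancel. -/
theorem exists_rename_inl_of_pderiv_inr_eq_zero {ι κ K : Type*} [Field K] [CharZero K]
    (f : MvPolynomial (ι ⊕ κ) K) (hf : ∀ k, pderiv (Sum.inr k) f = 0) :
    ∃ P : MvPolynomial ι K, MvPolynomial.rename Sum.inl P = f := by
  classical
  apply MvPolynomial.exists_rename_eq_of_vars_subset_range f _ Sum.inl_injective
  intro v hv
  rcases v with v | k
  · exact ⟨v, rfl⟩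
  exfalso
  obtain ⟨m, hm, hk⟩ := (MvPolynomial.mem_vars_iff_mem_support _).1 (Finset.mem_coe.1 hv)
  have h := congrArg (MvPolynomial.coeff (m - Finsupp.single (Sum.inr k) 1)) (hf k)
  rw [Finsupp.mem_support_iff] at hk
  have hle : Finsupp.single (Sum.inr k) 1 ≤ m := by
    rw [Finsupp.single_le_iff]; omega
  rw [MvPolynomial.coeff_pderiv, tsub_add_cancel_of_le hle, MvPolynomial.coeff_zero] at h
  rcases mul_eq_zero.1 h with h | h
  · exact (MvPolynomial.mem_support_iff.1 hm) h
  · exact absurd h (Nat.cast_add_one_ne_zero _)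

theorem totalDegree_pderiv_le {σ R : Type*} [CommSemiring R] (i : σ) (f : MvPolynomial σ R) :
    (pderiv i f).totalDegree ≤ f.totalDegree := by
  classical
  refine Finset.sup_le fun m hm => ?_
  have hm' : m + Finsupp.single i 1 ∈ f.support := by
    rw [MvPolynomial.mem_support_iff, MvPolynomial.coeff_pderiv] at hm
    exact MvPolynomial.mem_support_iff.2 (left_ne_zero_of_mul hm)
  refine le_trans ?_ (MvPolynomial.le_totalDegree hm')
  change m.degree ≤ (m + Finsupp.single i 1).degree
  simp

theorem pderiv_comm {σ R : Type*} [CommSemiring R] (i j : σ) (f : MvPolynomial σ R) :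
    pderiv i (pderiv j f) = pderiv j (pderiv i f) := by
  classical
  rcases eq_or_ne i j with rfl | hij
  · rfl
  ext m
  simp only [MvPolynomial.coeff_pderiv, Finsupp.add_apply, Finsupp.single_apply, hij, hij.symm,
    if_false, add_zero]
  rw [add_right_comm m, mul_right_comm]

/-- If `∂Q/∂w_j` is prime and does not divide `∂Q/∂w_k`, then a polynomial `f(z, w)` whose
`w`-gradient is everywhere parallel to that of `Q` is a polynomial in `z` and `Q`. -/
theorem exists_aeval_eq_of_pderiv_parallel {ι κ K : Type*} [Field K] [CharZero K]
    (Q : MvPolynomial (ι ⊕ κ) K) (j k : κ) (hp : Prime (pderiv (Sum.inr j) Q))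
    (hjk : ¬ pderiv (Sum.inr j) Q ∣ pderiv (Sum.inr k) Q) (f : MvPolynomial (ι ⊕ κ) K)
    (hf : ∀ i l, pderiv (Sum.inr i) Q * pderiv (Sum.inr l) f
      = pderiv (Sum.inr l) Q * pderiv (Sum.inr i) f) :
    ∃ F : MvPolynomial (ι ⊕ Unit) K,
      aeval (Sum.elim (fun i => X (Sum.inl i)) fun _ => Q) F = f := by
  classical
  induction hN : f.totalDegree using Nat.strong_induction_on generalizing f with
  | _ N ih =>
  subst hN
  obtain ⟨g, hg⟩ : pderiv (Sum.inr j) Q ∣ pderiv (Sum.inr j) f :=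
    (hp.dvd_or_dvd ⟨_, (hf j k).symm⟩).resolve_left hjk
  have hg' : ∀ i, pderiv (Sum.inr i) f = g * pderiv (Sum.inr i) Q := by
    intro i
    apply mul_left_cancel₀ hp.ne_zero
    rw [hf j i, hg]
    ring
  obtain ⟨G, hG⟩ : ∃ G : MvPolynomial (ι ⊕ Unit) K,
      aeval (Sum.elim (fun i => X (Sum.inl i)) fun _ => Q) G = g := by
    -- Degrees add only for nonzero factors, so `g = 0` is set apart. Otherwise the nonconstant
    -- factor `∂Q/∂w_j` makes the degree of `g` drop.
    by_cases hg0 : g = 0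
    · exact ⟨0, by simp [hg0]⟩
    apply ih g.totalDegree _ g _ rfl
    · have h1 : 0 < (pderiv (Sum.inr j) Q).totalDegree := by
        rw [Nat.pos_iff_ne_zero]
        intro h0
        rw [MvPolynomial.totalDegree_eq_zero_iff_eq_C] at h0
        apply hp.not_isUnit
        have hne := hp.ne_zero
        rw [h0] at hne ⊢
        exact (isUnit_iff_ne_zero.2 fun h => hne (by rw [h, map_zero])).map C
      have h2 := MvPolynomial.totalDegree_mul_of_isDomain hp.ne_zero hg0
      rw [← hg] at h2
      have h3 : (pderiv (Sum.inr j) f).totalDegree ≤ f.totalDegree :=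
        totalDegree_pderiv_le _ _
      omega
    -- Compute `∂_i ∂_l f` in both orders from `∇f = g ∇Q`; the terms `g ∂_i ∂_l Q` cancel and leave
    -- the relation for `g`.
    · intro i l
      have h1 := congrArg (pderiv (Sum.inr i)) (hg' l)
      have h2 := congrArg (pderiv (Sum.inr l)) (hg' i)
      rw [pderiv_comm, h2] at h1
      simp only [Derivation.leibniz, smul_eq_mul, pderiv_comm (Sum.inr i) (Sum.inr l) Q] at h1
      linear_combination h1
  -- With `H` an antiderivative of `G` in `s`, the `w`-gradient of `H(z, Q)` is `G(z, Q) ∇Q = g ∇Q =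
  -- ∇f`.
  obtain ⟨H, rfl⟩ := exists_pderiv_eq (Sum.inr ()) G
  obtain ⟨P, hP⟩ := exists_rename_inl_of_pderiv_inr_eq_zero
    (f - aeval (Sum.elim (fun i => X (Sum.inl i)) fun _ => Q) H) (by
      intro i
      rw [map_sub, derivation_aeval_sumElim _ _
        (fun j => MvPolynomial.pderiv_X_of_ne (by simp)), hG, hg', sub_self])
  refine ⟨H + MvPolynomial.rename Sum.inl P, ?_⟩
  rw [map_add, MvPolynomial.aeval_rename]
  have : (Sum.elim (fun i => X (Sum.inl i)) fun _ : Unit => Q) ∘ Sum.inl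
      = (X ∘ Sum.inl : ι → MvPolynomial (ι ⊕ κ) K) := rfl
  rw [this, ← MvPolynomial.rename_eq_aeval, hP]
  ring

theorem prime_of_isHomogeneous_one {σ K : Type*} [Field K] {p : MvPolynomial σ K}
    (hp : p.IsHomogeneous 1) (h0 : p ≠ 0) : Prime p := by
  rw [← UniqueFactorizationMonoid.irreducible_iff_prime]
  refine MvPolynomial.irreducible_of_totalDegree_eq_one (hp.totalDegree h0) fun x hx => ?_
  obtain ⟨m, hm⟩ := MvPolynomial.ne_zero_iff.1 h0
  exact isUnit_iff_ne_zero.2 fun h => hm (zero_dvd_iff.1 (h ▸ hx m))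

/-- Comparing total degrees, the cofactor has degree zero. -/
theorem exists_C_mul_eq_of_dvd {σ K : Type*} [Field K] {p q : MvPolynomial σ K}
    (hp : p.IsHomogeneous 1) (hq : q.IsHomogeneous 1) (h : p ∣ q) : ∃ c : K, q = C c * p := by
  obtain ⟨r, rfl⟩ := h
  by_cases h0 : p * r = 0
  · exact ⟨0, by simp [h0]⟩
  have h1 := MvPolynomial.totalDegree_mul_of_isDomain (left_ne_zero_of_mul h0)
    (right_ne_zero_of_mul h0)
  rw [hq.totalDegree h0, hp.totalDegree (left_ne_zero_of_mul h0)] at h1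
  have h2 := (MvPolynomial.totalDegree_eq_zero_iff_eq_C (p := r)).1 (by omega)
  exact ⟨r.coeff 0, by rw [mul_comm, ← h2]⟩

/-- The weights of the variables `z` and `s`. -/
abbrev graphWeight (ι : Type*) : ι ⊕ Unit → ℕ := Sum.elim (fun _ => 1) (fun _ => 2)

theorem isHomogeneous_aeval_monomial {ι κ K : Type*} [Field K] {Q : MvPolynomial (ι ⊕ κ) K}
    (hQ : Q.IsHomogeneous 2) (m : ι ⊕ Unit →₀ ℕ) (c : K) :
    (aeval (Sum.elim (fun i => X (Sum.inl i)) fun _ => Q) (monomial m c)).IsHomogeneous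
      (Finsupp.weight (graphWeight ι) m) := by
  rw [MvPolynomial.aeval_monomial, Finsupp.weight_apply, ← zero_add (m.sum _)]
  refine (MvPolynomial.isHomogeneous_C _ c).mul (MvPolynomial.IsHomogeneous.prod _ _ _ ?_)
  rintro (i | i) -
  · simpa using (MvPolynomial.isHomogeneous_X K (Sum.inl i)).pow (m (Sum.inl i))
  · simpa [mul_comm] using hQ.pow (m (Sum.inr i))

/-- The substitution `s = Q`, with `Q` quadratic, takes weighted homogeneous components to
homogeneous components. -/
theorem homogeneousComponent_aeval {ι κ K : Type*} [Field K] {Q : MvPolynomial (ι ⊕ κ) K}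
    (hQ : Q.IsHomogeneous 2) (d : ℕ) (F : MvPolynomial (ι ⊕ Unit) K) :
    MvPolynomial.homogeneousComponent d
        (aeval (Sum.elim (fun i => X (Sum.inl i)) fun _ => Q) F)
      = aeval (Sum.elim (fun i => X (Sum.inl i)) fun _ => Q)
          (MvPolynomial.weightedHomogeneousComponent (graphWeight ι) d F) := by
  classical
  induction F using MvPolynomial.induction_on' with
  | monomial m c =>
    rw [MvPolynomial.homogeneousComponent_of_mem (isHomogeneous_aeval_monomial hQ m c),
      MvPolynomial.weightedHomogeneousComponent_of_mem
        (MvPolynomial.isWeightedHomogeneous_monomial _ m c rfl)]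
    split_ifs <;> simp
  | add p q hp hq => simp only [map_add, hp, hq]

theorem exists_isWeightedHomogeneous_aeval_eq {ι κ K : Type*} [Field K]
    {Q : MvPolynomial (ι ⊕ κ) K} (hQ : Q.IsHomogeneous 2) {f : MvPolynomial (ι ⊕ κ) K}
    (hf : ∃ F : MvPolynomial (ι ⊕ Unit) K,
      aeval (Sum.elim (fun i => X (Sum.inl i)) fun _ => Q) F = f) {d : ℕ}
    (hd : f.IsHomogeneous d) :
    ∃ F : MvPolynomial (ι ⊕ Unit) K, F.IsWeightedHomogeneous (graphWeight ι) d ∧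
      aeval (Sum.elim (fun i => X (Sum.inl i)) fun _ => Q) F = f := by
  obtain ⟨F, rfl⟩ := hf
  refine ⟨_, MvPolynomial.weightedHomogeneousComponent_isWeightedHomogeneous d F, ?_⟩
  rw [← homogeneousComponent_aeval hQ, MvPolynomial.homogeneousComponent_eq_self hd]

end CRSing

end

noncomputable section

namespace CRSing

open MvPolynomial (aeval pderiv X C monomial)

/-! ### Orders of power series -/

section Order

variable {σ R : Type*} [CommRing R]

theorem mul_sub_mul_eq (a b c d : R) : a * b - c * d = (a - c) * b + c * (b - d) := by
  ring

theorem le_order_add {f g : MvPowerSeries σ R} {d : ℕ∞} (hf : d ≤ f.order) (hg : d ≤ g.order) :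
    d ≤ (f + g).order :=
  (le_min hf hg).trans MvPowerSeries.min_order_le_add

theorem le_order_sub {f g : MvPowerSeries σ R} {d : ℕ∞} (hf : d ≤ f.order) (hg : d ≤ g.order) :
    d ≤ (f - g).order := by
  rw [sub_eq_add_neg]
  exact le_order_add hf (by rwa [MvPowerSeries.order_neg])

theorem le_order_mul_of_le {f g : MvPowerSeries σ R} {a b c : ℕ} (hf : (a : ℕ∞) ≤ f.order)
    (hg : (b : ℕ∞) ≤ g.order) (h : c ≤ a + b) : (c : ℕ∞) ≤ (f * g).order :=
  (Nat.cast_le.2 h).trans <| by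
    rw [Nat.cast_add]
    exact (add_le_add hf hg).trans MvPowerSeries.le_order_mul

theorem le_order_pderiv {f : MvPowerSeries σ R} {a b : ℕ} (hf : (a : ℕ∞) ≤ f.order)
    (h : b ≤ a - 1) (i : σ) : (b : ℕ∞) ≤ (MvPowerSeries.pderiv R i f).order := by
  refine MvPowerSeries.le_order fun m hm => ?_
  rw [MvPowerSeries.coeff_pderiv, MvPowerSeries.coeff_of_lt_order, zero_mul]
  refine lt_of_lt_of_le ?_ hf
  have : m.degree < b := by exact_mod_cast hm
  rw [map_add, Finsupp.degree_single]
  exact_mod_cast (by omega : m.degree + 1 < a)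

theorem le_order_coe {p : MvPolynomial σ R} {d : ℕ} (hp : p.IsHomogeneous d) :
    (d : ℕ∞) ≤ (p : MvPowerSeries σ R).order := by
  refine MvPowerSeries.le_order fun m hm => ?_
  rw [MvPolynomial.coeff_coe]
  exact hp.coeff_eq_zero (Nat.cast_lt.1 hm).ne

theorem eq_zero_of_lt_order_coe {p : MvPolynomial σ R} {d : ℕ} (hp : p.IsHomogeneous d)
    (h : ((d + 1 : ℕ) : ℕ∞) ≤ (p : MvPowerSeries σ R).order) : p = 0 := by
  ext m
  rw [MvPolynomial.coeff_zero]
  by_cases hm : m.degree = d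
  · rw [← MvPolynomial.coeff_coe, MvPowerSeries.coeff_of_lt_order]
    refine lt_of_lt_of_le ?_ h
    exact_mod_cast (by omega : m.degree < d + 1)
  · exact hp.coeff_eq_zero hm

/-- The lowest order part of a power series of order at least `d`. -/
theorem exists_isHomogeneous_lt_order_sub [Finite σ] {f : MvPowerSeries σ R} {d : ℕ}
    (hf : (d : ℕ∞) ≤ f.order) : ∃ p : MvPolynomial σ R, p.IsHomogeneous d ∧
      ((d + 1 : ℕ) : ℕ∞) ≤ (f - (p : MvPowerSeries σ R)).order := by
  refine ⟨f.truncTotal (d + 1), ?_, ?_⟩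
  · intro m hm
    rw [MvPowerSeries.coeff_truncTotal_eq_ite] at hm
    have h1 : m.degree < d + 1 := by by_contra h; simp [h] at hm
    have h2 : ¬ m.degree < d := fun h => hm <| by
      rw [if_pos h1, MvPowerSeries.coeff_of_lt_order]
      exact lt_of_lt_of_le (by exact_mod_cast h) hf
    have h3 : Finsupp.weight (1 : σ → ℕ) m = m.degree := by
      rw [Finsupp.degree_eq_weight_one]; rfl
    rw [h3]; omega
  · refine MvPowerSeries.le_order fun m hm => ?_
    have hm' : m.degree < d + 1 := by exact_mod_cast hm
    rw [map_sub, MvPolynomial.coeff_coe, MvPowerSeries.coeff_truncTotal _ hm', sub_self]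

end Order

/-! ### Formal solution, one weighted degree at a time -/

section Formal

variable {ι κ K : Type*} [Field K]

/-- The substitution `z = z`, `s = r` for power series `r(z, w)`. -/
abbrev seriesSubst (r : MvPowerSeries (ι ⊕ κ) K) : ι ⊕ Unit → MvPowerSeries (ι ⊕ κ) K :=
  Sum.elim (fun i => MvPowerSeries.X (Sum.inl i)) fun _ => r

theorem coe_aeval_sumElim (Q : MvPolynomial (ι ⊕ κ) K) (F : MvPolynomial (ι ⊕ Unit) K) :
    ((aeval (Sum.elim (fun i => X (Sum.inl i)) fun _ => Q) F : MvPolynomial (ι ⊕ κ) K) :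
      MvPowerSeries (ι ⊕ κ) K) = aeval (seriesSubst (Q : MvPowerSeries (ι ⊕ κ) K)) F := by
  induction F using MvPolynomial.induction_on with
  | C c => simp [MvPowerSeries.algebraMap_apply]
  | add p q hp hq => rw [map_add, MvPolynomial.coe_add, hp, hq, map_add]
  | mul_X p i hp =>
    rw [map_mul, MvPolynomial.coe_mul, hp, map_mul, MvPolynomial.aeval_X, MvPolynomial.aeval_X]
    rcases i with i | i <;> simp

/-- Exchanging `q` for `r` affects only terms of order above the weight of `F`. The three bounds are
proved together because jointly they are multiplicative, by `ab - cd = (a - c)b + c(b - d)`; this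
reduces everything to the variables, where `s` has weight 2 and `r - q` has order at least 3. -/
theorem order_aeval_seriesSubst {r q : MvPowerSeries (ι ⊕ κ) K} (hr : ((2 : ℕ) : ℕ∞) ≤ r.order)
    (hq : ((2 : ℕ) : ℕ∞) ≤ q.order) (hrq : ((3 : ℕ) : ℕ∞) ≤ (r - q).order) {d : ℕ}
    {F : MvPolynomial (ι ⊕ Unit) K} (hF : F.IsWeightedHomogeneous (graphWeight ι) d) :
    (d : ℕ∞) ≤ (aeval (seriesSubst r) F).order ∧ (d : ℕ∞) ≤ (aeval (seriesSubst q) F).order ∧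
      ((d + 1 : ℕ) : ℕ∞) ≤ (aeval (seriesSubst r) F - aeval (seriesSubst q) F).order := by
  have hmul : ∀ {a b : ℕ} {p p' : MvPolynomial (ι ⊕ Unit) K},
      ((a : ℕ∞) ≤ (aeval (seriesSubst r) p).order ∧ (a : ℕ∞) ≤ (aeval (seriesSubst q) p).order ∧
        ((a + 1 : ℕ) : ℕ∞) ≤ (aeval (seriesSubst r) p - aeval (seriesSubst q) p).order) →
      ((b : ℕ∞) ≤ (aeval (seriesSubst r) p').order ∧
        (b : ℕ∞) ≤ (aeval (seriesSubst q) p').order ∧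
        ((b + 1 : ℕ) : ℕ∞) ≤ (aeval (seriesSubst r) p' - aeval (seriesSubst q) p').order) →
      (((a + b : ℕ) : ℕ∞) ≤ (aeval (seriesSubst r) (p * p')).order ∧
        ((a + b : ℕ) : ℕ∞) ≤ (aeval (seriesSubst q) (p * p')).order ∧
        ((a + b + 1 : ℕ) : ℕ∞)
          ≤ (aeval (seriesSubst r) (p * p') - aeval (seriesSubst q) (p * p')).order) := by
    rintro a b p p' ⟨h1, h2, h3⟩ ⟨h1', h2', h3'⟩
    simp only [map_mul]
    refine ⟨le_order_mul_of_le h1 h1' le_rfl, le_order_mul_of_le h2 h2' le_rfl, ?_⟩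
    rw [mul_sub_mul_eq]
    exact le_order_add (le_order_mul_of_le h3 h1' (by omega)) (le_order_mul_of_le h2 h3' (by omega))
  have hone : ∀ c : K, (((0 : ℕ) : ℕ∞) ≤ (aeval (seriesSubst r) (C c)).order ∧
      ((0 : ℕ) : ℕ∞) ≤ (aeval (seriesSubst q) (C c)).order ∧
      ((0 + 1 : ℕ) : ℕ∞) ≤ (aeval (seriesSubst r) (C c) - aeval (seriesSubst q) (C c)).order) := by
    intro c
    refine ⟨by simp, by simp, ?_⟩
    rw [MvPolynomial.aeval_C, MvPolynomial.aeval_C, sub_self, MvPowerSeries.order_zero]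
    exact le_top
  have hmon : ∀ m : ι ⊕ Unit →₀ ℕ,
      ((Finsupp.weight (graphWeight ι) m : ℕ) : ℕ∞)
          ≤ (aeval (seriesSubst r) (monomial m (1 : K))).order ∧
        ((Finsupp.weight (graphWeight ι) m : ℕ) : ℕ∞)
          ≤ (aeval (seriesSubst q) (monomial m (1 : K))).order ∧
        ((Finsupp.weight (graphWeight ι) m + 1 : ℕ) : ℕ∞)
          ≤ (aeval (seriesSubst r) (monomial m (1 : K))
            - aeval (seriesSubst q) (monomial m (1 : K))).order := by
    intro m
    induction m using Finsupp.induction_linear with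
    | zero => simp
    | add m m' h h' =>
      rw [map_add, ← one_mul (1 : K), ← MvPolynomial.monomial_mul]
      exact hmul h h'
    | single i k =>
      induction k with
      | zero => simp
      | succ k ih =>
        rw [Finsupp.single_add, map_add, ← one_mul (1 : K), ← MvPolynomial.monomial_mul]
        refine hmul ih ?_
        rw [← MvPolynomial.X]
        rcases i with i | i
        · have hX : ((1 : ℕ) : ℕ∞)
              ≤ (MvPowerSeries.X (Sum.inl i) : MvPowerSeries (ι ⊕ κ) K).order := by
            rw [← MvPolynomial.coe_X]
            exact le_order_coe (MvPolynomial.isHomogeneous_X K _)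
          simp only [MvPolynomial.aeval_X, Finsupp.weight_single, Sum.elim_inl, sub_self,
            MvPowerSeries.order_zero, smul_eq_mul, mul_one]
          exact ⟨hX, hX, le_top⟩
        · simp only [MvPolynomial.aeval_X, Finsupp.weight_single, Sum.elim_inr, smul_eq_mul,
            one_mul]
          exact ⟨hr, hq, hrq⟩
  induction hF using MvPolynomial.IsWeightedHomogeneous.induction_on with
  | zero => simp
  | add p p' _ _ h h' =>
    simp only [map_add, add_sub_add_comm]
    exact ⟨le_order_add h.1 h'.1, le_order_add h.2.1 h'.2.1, le_order_add h.2.2 h'.2.2⟩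
  | monomial m c hm =>
    subst hm
    rw [← mul_one c, ← MvPolynomial.C_mul_monomial, ← zero_add (Finsupp.weight _ m)]
    exact hmul (hone c) (hmon m)

/-- The `w`-gradient of `f(z, w)` is parallel to that of `r(z, w)`. -/
def IsParallel (r f : MvPowerSeries (ι ⊕ κ) K) : Prop :=
  ∀ i l : κ, MvPowerSeries.pderiv K (Sum.inr i) r * MvPowerSeries.pderiv K (Sum.inr l) f
    = MvPowerSeries.pderiv K (Sum.inr l) r * MvPowerSeries.pderiv K (Sum.inr i) f

/-- The gradient of `F(z, r)` is `F_s(z, r) ∇r`, a multiple of `∇r`, and the relations are linear in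
`f`. -/
theorem IsParallel.sub_aeval {r f : MvPowerSeries (ι ⊕ κ) K} (h : IsParallel r f)
    (F : MvPolynomial (ι ⊕ Unit) K) : IsParallel r (f - aeval (seriesSubst r) F) := by
  intro i l
  have hd : ∀ i : κ, MvPowerSeries.pderiv K (Sum.inr i) (aeval (seriesSubst r) F)
      = aeval (seriesSubst r) (pderiv (Sum.inr ()) F) * MvPowerSeries.pderiv K (Sum.inr i) r :=
    fun i => derivation_aeval_sumElim _ _
      (fun j => MvPowerSeries.pderiv_X_of_ne (by simp)) r F
  rw [map_sub, map_sub, hd, hd]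
  linear_combination h i l

variable [CharZero K] [Finite ι] [Finite κ]

/-- The lowest order part of a series whose gradient is parallel to that of `r = Q + O(3)` is a
polynomial in `z` and `Q`; replacing `Q` by `r` removes it from the series. -/
theorem exists_lt_order_sub_aeval {Q : MvPolynomial (ι ⊕ κ) K} (hQ : Q.IsHomogeneous 2)
    {j k : κ} (hp : Prime (pderiv (Sum.inr j) Q))
    (hjk : ¬ pderiv (Sum.inr j) Q ∣ pderiv (Sum.inr k) Q) {r f : MvPowerSeries (ι ⊕ κ) K}
    (hr : ((3 : ℕ) : ℕ∞) ≤ (r - (Q : MvPowerSeries (ι ⊕ κ) K)).order)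
    (hf : IsParallel r f) {d : ℕ} (hd : (d : ℕ∞) ≤ f.order) :
    ∃ F : MvPolynomial (ι ⊕ Unit) K, F.IsWeightedHomogeneous (graphWeight ι) d ∧
      ((d + 1 : ℕ) : ℕ∞) ≤ (f - aeval (seriesSubst r) F).order := by
  obtain ⟨p, hpd, hfp⟩ := exists_isHomogeneous_lt_order_sub hd
  have hQ2 := le_order_coe hQ
  have hr2 : ((2 : ℕ) : ℕ∞) ≤ r.order := by
    rw [← sub_add_cancel r (Q : MvPowerSeries (ι ⊕ κ) K)]
    exact le_order_add (le_trans (by norm_num) hr) hQ2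
  have hpar : ∀ i l, pderiv (Sum.inr i) Q * pderiv (Sum.inr l) p
      = pderiv (Sum.inr l) Q * pderiv (Sum.inr i) p := by
    intro i l
    -- For `d = 0` the part `p` is constant; the degree count `1 + (d - 1) = d` needs `d > 0`.
    rcases Nat.eq_zero_or_pos d with rfl | hd0
    · rw [(MvPolynomial.totalDegree_eq_zero_iff_eq_C (p := p)).1
        (Nat.le_zero.1 hpd.totalDegree_le)]
      simp
    have h1 : ∀ a b : κ, (pderiv (Sum.inr a) Q * pderiv (Sum.inr b) p).IsHomogeneous d := by
      intro a b
      have := (hQ.pderiv (i := Sum.inr a)).mul (hpd.pderiv (i := Sum.inr b))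
      rwa [show 2 - 1 + (d - 1) = d by omega] at this
    rw [← sub_eq_zero]
    refine eq_zero_of_lt_order_coe ((h1 i l).sub (h1 l i)) ?_
    -- The product `∂r ∂f` agrees with `∂Q ∂p` up to order `d + 1`: the errors have orders `2 + (d -
    -- 1)` and `1 + d`. So the relation for `(Q, p)`, homogeneous of degree `d`, is the leading part
    -- of the one for `(r, f)`.
    have hs : ∀ a b : κ, ((d + 1 : ℕ) : ℕ∞) ≤
        (MvPowerSeries.pderiv K (Sum.inr a) r * MvPowerSeries.pderiv K (Sum.inr b) f
          - MvPowerSeries.pderiv K (Sum.inr a) (Q : MvPowerSeries (ι ⊕ κ) K)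
            * MvPowerSeries.pderiv K (Sum.inr b) (p : MvPowerSeries (ι ⊕ κ) K)).order := by
      intro a b
      rw [mul_sub_mul_eq, ← map_sub, ← map_sub]
      exact le_order_add
        (le_order_mul_of_le (le_order_pderiv (b := 2) hr (by norm_num) _)
          (le_order_pderiv hd le_rfl _) (by omega))
        (le_order_mul_of_le (le_order_pderiv (b := 1) hQ2 (by norm_num) _)
          (le_order_pderiv hfp le_rfl _) (by omega))
    have h2 := le_order_sub (hs l i) (hs i l)
    rw [hf i l] at h2
    simp only [MvPowerSeries.pderiv_coe] at h2
    have h3 : ((pderiv (Sum.inr i) Q * pderiv (Sum.inr l) p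
        - pderiv (Sum.inr l) Q * pderiv (Sum.inr i) p : MvPolynomial (ι ⊕ κ) K) :
          MvPowerSeries (ι ⊕ κ) K)
        = (pderiv (Sum.inr i) Q : MvPolynomial (ι ⊕ κ) K)
            * (pderiv (Sum.inr l) p : MvPolynomial (ι ⊕ κ) K)
          - (pderiv (Sum.inr l) Q : MvPolynomial (ι ⊕ κ) K)
            * (pderiv (Sum.inr i) p : MvPolynomial (ι ⊕ κ) K) := by
      rw [eq_sub_iff_add_eq]
      simp only [← MvPolynomial.coe_mul, ← MvPolynomial.coe_add, sub_add_cancel]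
    rw [h3]
    convert h2 using 2
    ring
  obtain ⟨F, hFd, rfl⟩ := exists_isWeightedHomogeneous_aeval_eq hQ
    (exists_aeval_eq_of_pderiv_parallel Q j k hp hjk p hpar) hpd
  refine ⟨F, hFd, ?_⟩
  have h := (order_aeval_seriesSubst hr2 hQ2 hr hFd).2.2
  rw [coe_aeval_sumElim] at hfp
  have := le_order_sub hfp h
  rwa [sub_sub_sub_cancel_right] at this

/-- A power series whose `w`-gradient is parallel to that of `r = Q + O(3)` is a power series in
`z` and `r`. -/
theorem exists_subst_eq_of_isParallel {Q : MvPolynomial (ι ⊕ κ) K} (hQ : Q.IsHomogeneous 2)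
    {j k : κ} (hp : Prime (pderiv (Sum.inr j) Q))
    (hjk : ¬ pderiv (Sum.inr j) Q ∣ pderiv (Sum.inr k) Q) {r f : MvPowerSeries (ι ⊕ κ) K}
    (hr : ((3 : ℕ) : ℕ∞) ≤ (r - (Q : MvPowerSeries (ι ⊕ κ) K)).order)
    (hf : IsParallel r f) :
    MvPowerSeries.HasSubst (seriesSubst r) ∧
      ∃ F : MvPowerSeries (ι ⊕ Unit) K, MvPowerSeries.subst (seriesSubst r) F = f := by
  classical
  have hr2 : ((2 : ℕ) : ℕ∞) ≤ r.order := by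
    rw [← sub_add_cancel r (Q : MvPowerSeries (ι ⊕ κ) K)]
    exact le_order_add (le_trans (by norm_num) hr) (le_order_coe hQ)
  have hsub : MvPowerSeries.HasSubst (seriesSubst r) := by
    apply MvPowerSeries.hasSubst_of_constantCoeff_zero
    rintro (i | i)
    · simp
    · change MvPowerSeries.constantCoeff r = 0
      rw [← MvPowerSeries.one_le_order_iff_constCoeff_eq_zero]
      exact le_trans (by norm_num) hr2
  refine ⟨hsub, ?_⟩
  -- Stated for every `h`, with correction `0` as default, so that it yields a total function `S`
  -- whose values are weighted homogeneous unconditionally.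
  have hstep : ∀ (d : ℕ) (h : MvPowerSeries (ι ⊕ κ) K), ∃ F : MvPolynomial (ι ⊕ Unit) K,
      F.IsWeightedHomogeneous (graphWeight ι) d ∧
        (IsParallel r h → (d : ℕ∞) ≤ h.order →
          ((d + 1 : ℕ) : ℕ∞) ≤ (h - aeval (seriesSubst r) F).order) := by
    intro d h
    by_cases hh : IsParallel r h ∧ (d : ℕ∞) ≤ h.order
    · obtain ⟨F, h1, h2⟩ := exists_lt_order_sub_aeval hQ hp hjk hr hh.1 hh.2
      exact ⟨F, h1, fun _ _ => h2⟩
    · exact ⟨0, MvPolynomial.isWeightedHomogeneous_zero _ _ _, fun h1 h2 => absurd ⟨h1, h2⟩ hh⟩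
  choose S hSd hS using hstep
  obtain ⟨P, hP⟩ : ∃ P : ℕ → MvPolynomial (ι ⊕ Unit) K,
      ∀ d, P (d + 1) = P d + S d (f - aeval (seriesSubst r) (P d)) :=
    ⟨fun N => Nat.rec 0 (fun d p => p + S d (f - aeval (seriesSubst r) p)) N, fun _ => rfl⟩
  have hord : ∀ d : ℕ, (d : ℕ∞) ≤ (f - aeval (seriesSubst r) (P d)).order := by
    intro d
    induction d with
    | zero => simp
    | succ d ih =>
      rw [hP, map_add, ← sub_sub]
      exact hS _ _ (hf.sub_aeval _) ih
  -- The step from `P N` to `P (N + 1)` adds only terms of weight `N`, so the coefficient at `m` is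
  -- final from index weight of `m` plus one onwards.
  have hstab : ∀ (m : ι ⊕ Unit →₀ ℕ) (N : ℕ), Finsupp.weight (graphWeight ι) m + 1 ≤ N →
      (P N).coeff m = (P (Finsupp.weight (graphWeight ι) m + 1)).coeff m := by
    intro m N hN
    induction N, hN using Nat.le_induction with
    | base => rfl
    | succ N hN ih =>
      rw [hP, MvPolynomial.coeff_add, ih, (hSd _ _).coeff_eq_zero m (by omega), add_zero]
  let F : MvPowerSeries (ι ⊕ Unit) K :=
    fun m => (P (Finsupp.weight (graphWeight ι) m + 1)).coeff m
  have hF : ∀ m, MvPowerSeries.coeff m F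
      = (P (Finsupp.weight (graphWeight ι) m + 1)).coeff m := fun m => rfl
  refine ⟨F, ?_⟩
  -- The difference `F - P N` has only monomials of weight at least `N`, and substitution sends
  -- weight to at least that order. Thus `subst F - f` has infinite order.
  have hclose : ∀ N : ℕ, (N : ℕ∞) ≤ (MvPowerSeries.subst (seriesSubst r) F - f).order := by
    intro N
    have h1 : MvPowerSeries.subst (seriesSubst r) F - f
        = MvPowerSeries.subst (seriesSubst r) (F - MvPolynomial.toMvPowerSeries (P N))
          - (f - aeval (seriesSubst r) (P N)) := by
      rw [MvPowerSeries.subst_sub hsub, MvPowerSeries.subst_coe]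
      ring
    rw [h1]
    refine le_order_sub (le_trans ?_ (MvPowerSeries.le_weightedOrder_subst _ hsub _)) (hord N)
    refine le_iInf₂ fun m hm => ?_
    have hmN : N ≤ Finsupp.weight (graphWeight ι) m := by
      by_contra hlt
      apply hm
      rw [map_sub, MvPolynomial.coeff_coe, hF, hstab m N (by omega), sub_self]
    refine (Nat.cast_le.2 hmN).trans ?_
    rw [Finsupp.weight_apply, Finsupp.weight_apply, Finsupp.sum, Finsupp.sum, Nat.cast_sum]
    refine Finset.sum_le_sum fun i _ => ?_
    rw [smul_eq_mul, Nat.cast_mul, nsmul_eq_mul]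
    refine mul_le_mul_right ?_ _
    rcases i with i | i
    · change ((1 : ℕ) : ℕ∞) ≤ (MvPowerSeries.X (Sum.inl i) : MvPowerSeries (ι ⊕ κ) K).order
      rw [← MvPolynomial.coe_X]
      exact le_order_coe (MvPolynomial.isHomogeneous_X K _)
    · exact hr2
  rw [← sub_eq_zero, ← MvPowerSeries.order_eq_top_iff, ENat.eq_top_iff_forall_ge]
  exact hclose

end Formal

end CRSing

end

/-! ### Wirtinger derivatives near the origin -/

noncomputable section

namespace CRSing

open Filter Asymptotics

theorem multiindex_induction {σ : Type*} {p : (σ →₀ ℕ) → Prop} (h0 : p 0)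
    (hs : ∀ m i, p m → p (m + Finsupp.single i 1)) (m : σ →₀ ℕ) : p m := by
  induction m using Finsupp.induction with
  | zero => exact h0
  | single_add i k m _ _ ih =>
    rw [add_comm]
    clear * - ih hs
    induction k with
    | zero => simpa using ih
    | succ k ih' =>
      rw [Finsupp.single_add, ← add_assoc]
      exact hs _ _ ih'

/-- The induction step for comparing series: the derivative's coefficient at `m` is `m i + 1` times
the next coefficient, and this factor is nonzero. -/
theorem coeff_add_single_eq {σ : Type*} {S T : MvPowerSeries σ ℂ} {m : σ →₀ ℕ} {i : σ}
    (h : MvPowerSeries.coeff m (MvPowerSeries.pderiv ℂ i S)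
      = MvPowerSeries.coeff m (MvPowerSeries.pderiv ℂ i T)) :
    MvPowerSeries.coeff (m + Finsupp.single i 1) S
      = MvPowerSeries.coeff (m + Finsupp.single i 1) T := by
  rw [MvPowerSeries.coeff_pderiv, MvPowerSeries.coeff_pderiv] at h
  exact mul_right_cancel₀ (Nat.cast_add_one_ne_zero _) h

theorem le_order_of_pderiv {σ : Type*} {S : MvPowerSeries σ ℂ} {d : ℕ}
    (h0 : MvPowerSeries.coeff 0 S = 0)
    (h : ∀ i, (d : ℕ∞) ≤ (MvPowerSeries.pderiv ℂ i S).order) :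
    ((d + 1 : ℕ) : ℕ∞) ≤ S.order := by
  refine MvPowerSeries.le_order fun m => ?_
  refine multiindex_induction (p := fun m => ((m.degree : ℕ) : ℕ∞) < ((d + 1 : ℕ) : ℕ∞) →
    MvPowerSeries.coeff m S = 0) (fun _ => h0) (fun m i _ hm => ?_) m
  rw [← map_zero (MvPowerSeries.coeff (R := ℂ) (m + Finsupp.single i 1))]
  apply coeff_add_single_eq
  rw [map_zero, map_zero]
  apply MvPowerSeries.coeff_of_lt_order
  refine lt_of_lt_of_le ?_ (h i)
  rw [map_add, Finsupp.degree_single] at hm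
  have : m.degree + 1 < d + 1 := by exact_mod_cast hm
  exact_mod_cast (by omega : m.degree < d)

section Wirtinger

variable {n : ℕ}

/-- `∂/∂z_j` for `i = Sum.inl j` and `∂/∂z̄_j` for `i = Sum.inr j`. -/
def wirt (i : Fin n ⊕ Fin n) (f : (Fin n → ℂ) → ℂ) : (Fin n → ℂ) → ℂ :=
  Sum.elim (fun j => dz j f) (fun j => dzbar j f) i

/-- The value of a real linear map on the complexified vector `∂/∂z_j` or `∂/∂z̄_j`. -/
def wirtLin (i : Fin n ⊕ Fin n) : ((Fin n → ℂ) →L[ℝ] ℂ) →L[ℝ] ℂ :=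
  (2⁻¹ : ℂ) • (ContinuousLinearMap.apply ℝ ℂ (Pi.single (Sum.elim id id i) 1)
    + (Sum.elim (fun _ => -Complex.I) (fun _ => Complex.I) i : ℂ) •
      ContinuousLinearMap.apply ℝ ℂ (Pi.single (Sum.elim id id i) Complex.I))

theorem wirtLin_apply (i : Fin n ⊕ Fin n) (L : (Fin n → ℂ) →L[ℝ] ℂ) :
    wirtLin i L = (2⁻¹ : ℂ) * (L (Pi.single (Sum.elim id id i) 1)
      + (Sum.elim (fun _ => -Complex.I) (fun _ => Complex.I) i : ℂ) *
        L (Pi.single (Sum.elim id id i) Complex.I)) := rfl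

theorem wirtLin_mul (i : Fin n ⊕ Fin n) (c : ℂ) (L : (Fin n → ℂ) →L[ℝ] ℂ) :
    wirtLin i (c • L) = c * wirtLin i L := by
  simp only [wirtLin_apply, _root_.smul_apply, smul_eq_mul]
  ring

theorem wirt_eq (i : Fin n ⊕ Fin n) (f : (Fin n → ℂ) → ℂ) (z : Fin n → ℂ) :
    wirt i f z = wirtLin i (fderiv ℝ f z) := by
  rcases i with j | j <;> simp [wirt, dz, dzbar, wirtLin_apply] <;> ring

/-- Smoothness near the origin. -/
abbrev SmoothAtZero (f : (Fin n → ℂ) → ℂ) : Prop := ContDiffAt ℝ ∞ f 0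

theorem SmoothAtZero.eventually_differentiableAt {f : (Fin n → ℂ) → ℂ} (hf : SmoothAtZero f) :
    ∀ᶠ z in 𝓝 0, DifferentiableAt ℝ f z := by
  have h1 : ContDiffAt ℝ 1 f 0 := hf.of_le (by exact_mod_cast le_top)
  filter_upwards [h1.eventually (by simp)] with z hz
  exact hz.differentiableAt one_ne_zero

theorem SmoothAtZero.fderiv {f : (Fin n → ℂ) → ℂ} (hf : SmoothAtZero f) :
    ContDiffAt ℝ ∞ (fderiv ℝ f) 0 :=
  hf.fderiv_right (by simp)

theorem SmoothAtZero.wirt {f : (Fin n → ℂ) → ℂ} (hf : SmoothAtZero f) (i : Fin n ⊕ Fin n) :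
    SmoothAtZero (wirt i f) := by
  have : CRSing.wirt i f = fun z => wirtLin i (_root_.fderiv ℝ f z) := funext (wirt_eq i f)
  rw [this]
  exact (wirtLin i).contDiff.contDiffAt.comp 0 hf.fderiv

theorem SmoothAtZero.add {f g : (Fin n → ℂ) → ℂ} (hf : SmoothAtZero f) (hg : SmoothAtZero g) :
    SmoothAtZero (f + g) :=
  ContDiffAt.add hf hg

theorem SmoothAtZero.mul {f g : (Fin n → ℂ) → ℂ} (hf : SmoothAtZero f) (hg : SmoothAtZero g) :
    SmoothAtZero (f * g) :=
  ContDiffAt.mul hf hg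

/-- The calculus is done with germs at `0`: the rules hold only near `0`, and equality of germs,
unlike equality of values, survives further differentiation. -/
theorem wirt_congr {f g : (Fin n → ℂ) → ℂ} (h : f =ᶠ[𝓝 0] g) (i : Fin n ⊕ Fin n) :
    wirt i f =ᶠ[𝓝 0] wirt i g := by
  filter_upwards [h.fderiv (𝕜 := ℝ)] with z hz
  rw [wirt_eq, wirt_eq, hz]

theorem wirt_add {f g : (Fin n → ℂ) → ℂ} (hf : SmoothAtZero f) (hg : SmoothAtZero g)
    (i : Fin n ⊕ Fin n) : wirt i (f + g) =ᶠ[𝓝 0] wirt i f + wirt i g := by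
  filter_upwards [hf.eventually_differentiableAt, hg.eventually_differentiableAt] with z h1 h2
  rw [Pi.add_apply, wirt_eq, wirt_eq, wirt_eq, fderiv_add h1 h2, map_add]

theorem wirt_mul {f g : (Fin n → ℂ) → ℂ} (hf : SmoothAtZero f) (hg : SmoothAtZero g)
    (i : Fin n ⊕ Fin n) : wirt i (f * g) =ᶠ[𝓝 0] f * wirt i g + g * wirt i f := by
  filter_upwards [hf.eventually_differentiableAt, hg.eventually_differentiableAt] with z h1 h2
  rw [Pi.add_apply, Pi.mul_apply, Pi.mul_apply, wirt_eq, wirt_eq, wirt_eq, fderiv_mul h1 h2,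
    map_add, wirtLin_mul, wirtLin_mul]

theorem wirt_const (c : ℂ) (i : Fin n ⊕ Fin n) :
    wirt i (fun _ : Fin n → ℂ => c) = fun _ => 0 := by
  funext z
  rw [wirt_eq, fderiv_const_apply, map_zero]

theorem wirt_comm {f : (Fin n → ℂ) → ℂ} (hf : SmoothAtZero f) (i j : Fin n ⊕ Fin n) :
    wirt i (wirt j f) =ᶠ[𝓝 0] wirt j (wirt i f) := by
  have h2 : ContDiffAt ℝ 2 f 0 := by exact_mod_cast contDiffAt_infty.1 hf 2
  filter_upwards [h2.eventually (by simp)] with z hz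
  have hd : DifferentiableAt ℝ (fderiv ℝ f) z :=
    (hz.fderiv_right (m := 1) (by norm_num)).differentiableAt one_ne_zero
  have hw : ∀ (k : Fin n ⊕ Fin n) (v : Fin n → ℂ),
      fderiv ℝ (wirt k f) z v = wirtLin k (fderiv ℝ (fderiv ℝ f) z v) := by
    intro k v
    have : wirt k f = fun w => wirtLin k (fderiv ℝ f w) := funext (wirt_eq k f)
    rw [this]
    have h := ((wirtLin k).hasFDerivAt.comp z hd.hasFDerivAt).fderiv
    rw [Function.comp_def] at h
    rw [h]
    rfl
  have hs : ∀ v w, fderiv ℝ (fderiv ℝ f) z v w = fderiv ℝ (fderiv ℝ f) z w v := fun v w =>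
    (hz.isSymmSndFDerivAt (by simp)).eq v w
  rw [wirt_eq, wirt_eq]
  simp only [wirtLin_apply, hw]
  rw [hs (Pi.single (Sum.elim id id i) 1), hs (Pi.single (Sum.elim id id i) Complex.I),
    hs (Pi.single (Sum.elim id id i) 1), hs (Pi.single (Sum.elim id id i) Complex.I)]
  ring

theorem SmoothAtZero.iterate_wirt {f : (Fin n → ℂ) → ℂ} (hf : SmoothAtZero f)
    (i : Fin n ⊕ Fin n) (k : ℕ) : SmoothAtZero ((CRSing.wirt i)^[k] f) := by
  induction k with
  | zero => exact hf
  | succ k ih => rw [Function.iterate_succ_apply']; exact ih.wirt i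

theorem iterate_wirt_congr {f g : (Fin n → ℂ) → ℂ} (h : f =ᶠ[𝓝 0] g) (i : Fin n ⊕ Fin n)
    (k : ℕ) : (wirt i)^[k] f =ᶠ[𝓝 0] (wirt i)^[k] g := by
  induction k with
  | zero => exact h
  | succ k ih =>
    rw [Function.iterate_succ_apply', Function.iterate_succ_apply']
    exact wirt_congr ih i

theorem iterate_wirt_comm {f : (Fin n → ℂ) → ℂ} (hf : SmoothAtZero f) (i j : Fin n ⊕ Fin n)
    (k : ℕ) : (wirt i)^[k] (wirt j f) =ᶠ[𝓝 0] wirt j ((wirt i)^[k] f) := by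
  induction k with
  | zero => rfl
  | succ k ih =>
    rw [Function.iterate_succ_apply', Function.iterate_succ_apply']
    exact (wirt_congr ih i).trans (wirt_comm (hf.iterate_wirt i k) i j)

/-- The iterated derivative along the list `l` of indices, with variables `t j` and exponents
`k j`. -/
def wirtFold (t : Fin n → Fin n ⊕ Fin n) (k : Fin n → ℕ) (l : List (Fin n))
    (f : (Fin n → ℂ) → ℂ) : (Fin n → ℂ) → ℂ :=
  l.foldr (fun j g => (wirt (t j))^[k j] g) f

theorem iterWirtinger_eq_wirtFold (m : Fin n ⊕ Fin n →₀ ℕ) (f : (Fin n → ℂ) → ℂ) :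
    iterWirtinger m f = wirtFold Sum.inl (fun j => m (Sum.inl j)) (List.finRange n)
      (wirtFold Sum.inr (fun j => m (Sum.inr j)) (List.finRange n) f) := rfl

theorem SmoothAtZero.wirtFold {f : (Fin n → ℂ) → ℂ} (hf : SmoothAtZero f)
    (t : Fin n → Fin n ⊕ Fin n) (k : Fin n → ℕ) (l : List (Fin n)) :
    SmoothAtZero (wirtFold t k l f) := by
  induction l with
  | nil => exact hf
  | cons a l ih => exact ih.iterate_wirt _ _

theorem wirtFold_congr {f g : (Fin n → ℂ) → ℂ} (h : f =ᶠ[𝓝 0] g)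
    (t : Fin n → Fin n ⊕ Fin n) (k : Fin n → ℕ) (l : List (Fin n)) :
    wirtFold t k l f =ᶠ[𝓝 0] wirtFold t k l g := by
  induction l with
  | nil => exact h
  | cons a l ih => exact iterate_wirt_congr ih _ _

theorem wirtFold_comm {f : (Fin n → ℂ) → ℂ} (hf : SmoothAtZero f)
    (t : Fin n → Fin n ⊕ Fin n) (k : Fin n → ℕ) (l : List (Fin n)) (i : Fin n ⊕ Fin n) :
    wirtFold t k l (wirt i f) =ᶠ[𝓝 0] wirt i (wirtFold t k l f) := by
  induction l with
  | nil => rfl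
  | cons a l ih =>
    exact (iterate_wirt_congr ih _ _).trans (iterate_wirt_comm (hf.wirtFold t k l) _ _ _)

theorem wirtFold_congr_exponents (f : (Fin n → ℂ) → ℂ) (t : Fin n → Fin n ⊕ Fin n)
    {k k' : Fin n → ℕ} {l : List (Fin n)} (h : ∀ j ∈ l, k j = k' j) :
    wirtFold t k l f = wirtFold t k' l f := by
  induction l with
  | nil => rfl
  | cons a l ih =>
    change (wirt (t a))^[k a] (wirtFold t k l f) = (wirt (t a))^[k' a] (wirtFold t k' l f)
    rw [h a (by simp), ih fun j hj => h j (by simp [hj])]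

theorem wirtFold_succ {f : (Fin n → ℂ) → ℂ} (hf : SmoothAtZero f)
    (t : Fin n → Fin n ⊕ Fin n) {k k' : Fin n → ℕ} {l : List (Fin n)} (hl : l.Nodup) {j : Fin n}
    (hj : j ∈ l) (hk : k' j = k j + 1) (hk' : ∀ i, i ≠ j → k' i = k i) :
    wirtFold t k' l f =ᶠ[𝓝 0] wirt (t j) (wirtFold t k l f) := by
  induction l with
  | nil => simp at hj
  | cons a l ih =>
    rw [List.nodup_cons] at hl
    change (wirt (t a))^[k' a] (wirtFold t k' l f)
      =ᶠ[𝓝 0] wirt (t j) ((wirt (t a))^[k a] (wirtFold t k l f))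
    rcases eq_or_ne j a with rfl | hja
    · rw [hk, Function.iterate_succ_apply',
        wirtFold_congr_exponents f t fun i hi => hk' i (by rintro rfl; exact hl.1 hi)]
    · rw [hk' a hja.symm]
      have hj' : j ∈ l := by simpa [hja] using hj
      exact (iterate_wirt_congr (ih hl.2 hj') _ _).trans
        (iterate_wirt_comm (hf.wirtFold t k l) _ _ _)

theorem iterWirtinger_congr {f g : (Fin n → ℂ) → ℂ} (h : f =ᶠ[𝓝 0] g)
    (m : Fin n ⊕ Fin n →₀ ℕ) : iterWirtinger m f =ᶠ[𝓝 0] iterWirtinger m g := by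
  rw [iterWirtinger_eq_wirtFold, iterWirtinger_eq_wirtFold]
  exact wirtFold_congr (wirtFold_congr h _ _ _) _ _ _

theorem iterWirtinger_wirt {f : (Fin n → ℂ) → ℂ} (hf : SmoothAtZero f)
    (m : Fin n ⊕ Fin n →₀ ℕ) (i : Fin n ⊕ Fin n) :
    iterWirtinger m (wirt i f) =ᶠ[𝓝 0] wirt i (iterWirtinger m f) := by
  rw [iterWirtinger_eq_wirtFold, iterWirtinger_eq_wirtFold]
  exact (wirtFold_congr (wirtFold_comm hf _ _ _ i) _ _ _).trans
    (wirtFold_comm (hf.wirtFold _ _ _) _ _ _ i)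

/-- The operators commute on germs, so the additional derivative can be moved to the front of the
fixed order of differentiation. -/
theorem iterWirtinger_add_single {f : (Fin n → ℂ) → ℂ} (hf : SmoothAtZero f)
    (m : Fin n ⊕ Fin n →₀ ℕ) (i : Fin n ⊕ Fin n) :
    iterWirtinger (m + Finsupp.single i 1) f =ᶠ[𝓝 0] wirt i (iterWirtinger m f) := by
  rw [iterWirtinger_eq_wirtFold, iterWirtinger_eq_wirtFold]
  rcases i with j | j
  · have h : (fun l => (m + Finsupp.single (Sum.inl j) 1 : Fin n ⊕ Fin n →₀ ℕ) (Sum.inr l) :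
      Fin n → ℕ)
        = fun l => m (Sum.inr l) := by
      funext l; simp
    rw [h]
    exact wirtFold_succ (hf.wirtFold _ _ _) _ (List.nodup_finRange n) (List.mem_finRange j)
      (by simp) (fun i hi => by simp [hi])
  · have h : (fun l => (m + Finsupp.single (Sum.inr j) 1 : Fin n ⊕ Fin n →₀ ℕ) (Sum.inl l) :
      Fin n → ℕ)
        = fun l => m (Sum.inl l) := by
      funext l; simp
    rw [h]
    exact (wirtFold_congr (wirtFold_succ hf _ (List.nodup_finRange n) (List.mem_finRange j)
      (by simp) (fun i hi => by simp [hi])) _ _ _).trans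
        (wirtFold_comm (hf.wirtFold _ _ _) _ _ _ _)

end Wirtinger

/-! ### Taylor expansion as a differential ring homomorphism -/

section Taylor

variable {n : ℕ}

theorem coeff_taylorSeries (f : (Fin n → ℂ) → ℂ) (m : Fin n ⊕ Fin n →₀ ℕ) :
    MvPowerSeries.coeff m (taylorSeries f)
      = iterWirtinger m f 0 / ((∏ i, (m i)! : ℕ) : ℂ) := rfl

theorem taylorSeries_congr {f g : (Fin n → ℂ) → ℂ} (h : f =ᶠ[𝓝 0] g) :
    taylorSeries f = taylorSeries g := by
  ext m
  rw [coeff_taylorSeries, coeff_taylorSeries, (iterWirtinger_congr h m).eq_of_nhds]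

theorem coeff_zero_taylorSeries (f : (Fin n → ℂ) → ℂ) :
    MvPowerSeries.coeff 0 (taylorSeries f) = f 0 := by
  have : ∀ (t : Fin n → Fin n ⊕ Fin n) (l : List (Fin n)) (g : (Fin n → ℂ) → ℂ),
      wirtFold t (fun _ => 0) l g = g := by
    intro t l g
    induction l with
    | nil => rfl
    | cons a l ih => exact ih
  rw [coeff_taylorSeries, iterWirtinger_eq_wirtFold]
  simp only [Finsupp.coe_zero, Pi.zero_apply, this]
  simp

/-- The factor `m i + 1` from formal differentiation cancels against `(m + e_i)! = (m_i + 1) m!`. -/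
theorem pderiv_taylorSeries {f : (Fin n → ℂ) → ℂ} (hf : SmoothAtZero f) (i : Fin n ⊕ Fin n) :
    MvPowerSeries.pderiv ℂ i (taylorSeries f) = taylorSeries (wirt i f) := by
  classical
  ext m
  rw [MvPowerSeries.coeff_pderiv, coeff_taylorSeries, coeff_taylorSeries,
    (iterWirtinger_add_single hf m i).eq_of_nhds, (iterWirtinger_wirt hf m i).eq_of_nhds]
  have h1 : (∏ j, ((m + Finsupp.single i 1 : Fin n ⊕ Fin n →₀ ℕ) j)! : ℕ)
      = (m i + 1) * ∏ j, (m j)! := by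
    rw [← Finset.mul_prod_erase _ _ (Finset.mem_univ i),
      ← Finset.mul_prod_erase _ (fun j => (m j)!) (Finset.mem_univ i), ← mul_assoc]
    congr 1
    · simp [Nat.factorial_succ]
    · refine Finset.prod_congr rfl fun j hj => ?_
      simp [(Finset.ne_of_mem_erase hj)]
  have h2 : ((∏ j, (m j)! : ℕ) : ℂ) ≠ 0 :=
    Nat.cast_ne_zero.2 (Finset.prod_ne_zero_iff.2 fun j _ => Nat.factorial_ne_zero _)
  have h3 : (m i + 1 : ℂ) ≠ 0 := Nat.cast_add_one_ne_zero _
  rw [h1, Nat.cast_mul, Nat.cast_add, Nat.cast_one]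
  field_simp

theorem taylorSeries_add {f g : (Fin n → ℂ) → ℂ} (hf : SmoothAtZero f) (hg : SmoothAtZero g) :
    taylorSeries (f + g) = taylorSeries f + taylorSeries g := by
  ext m
  induction m using multiindex_induction generalizing f g with
  | h0 => simp only [map_add, coeff_zero_taylorSeries, Pi.add_apply]
  | hs m i ih =>
    apply coeff_add_single_eq
    rw [pderiv_taylorSeries (f := f + g) (SmoothAtZero.add hf hg),
      taylorSeries_congr (wirt_add hf hg i),
      ih (hf.wirt i) (hg.wirt i), map_add (MvPowerSeries.pderiv ℂ i), pderiv_taylorSeries hf,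
      pderiv_taylorSeries hg]

/-- Both sides obey the Leibniz rule, so the coefficient at `m + e_i` reduces to coefficients at `m`
for products with differentiated factors; hence the induction runs over all `f` and `g` at once. -/
theorem taylorSeries_mul {f g : (Fin n → ℂ) → ℂ} (hf : SmoothAtZero f) (hg : SmoothAtZero g) :
    taylorSeries (f * g) = taylorSeries f * taylorSeries g := by
  ext m
  induction m using multiindex_induction generalizing f g with
  | h0 =>
    rw [coeff_zero_taylorSeries, MvPowerSeries.coeff_zero_eq_constantCoeff_apply, map_mul,
      ← MvPowerSeries.coeff_zero_eq_constantCoeff_apply,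
      ← MvPowerSeries.coeff_zero_eq_constantCoeff_apply, coeff_zero_taylorSeries,
      coeff_zero_taylorSeries, Pi.mul_apply]
  | hs m i ih =>
    apply coeff_add_single_eq
    rw [pderiv_taylorSeries (f := f * g) (SmoothAtZero.mul hf hg),
      taylorSeries_congr (wirt_mul hf hg i),
      taylorSeries_add (SmoothAtZero.mul hf (hg.wirt i)) (SmoothAtZero.mul hg (hf.wirt i)), Derivation.leibniz, map_add,
      map_add, ih hf (hg.wirt i), ih hg (hf.wirt i), pderiv_taylorSeries hf,
      pderiv_taylorSeries hg, smul_eq_mul, smul_eq_mul]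

theorem taylorSeries_const (c : ℂ) :
    taylorSeries (fun _ : Fin n → ℂ => c) = MvPowerSeries.C c := by
  have h0 : taylorSeries (fun _ : Fin n → ℂ => (0 : ℂ)) = 0 := by
    have := taylorSeries_add (n := n) (f := fun _ => 0) (g := fun _ => 0) contDiffAt_const
      contDiffAt_const
    have h : ((fun _ => 0) + fun _ => 0 : (Fin n → ℂ) → ℂ) = fun _ => 0 := by
      funext z; simp
    rw [h] at this
    exact left_eq_add.1 this
  apply MvPowerSeries.pderiv.ext
  · intro i
    rw [pderiv_taylorSeries contDiffAt_const, wirt_const, h0, MvPowerSeries.pderiv_C]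
  · rw [← MvPowerSeries.coeff_zero_eq_constantCoeff_apply, coeff_zero_taylorSeries,
      MvPowerSeries.constantCoeff_C]

/-- The values `(z, z̄)` of the coordinate functions. -/
abbrev coordVec (z : Fin n → ℂ) : Fin n ⊕ Fin n → ℂ := Sum.elim z fun j => conj (z j)

/-- The coordinate functions `z_j` and `z̄_j` as real linear maps. -/
def coordLin (i : Fin n ⊕ Fin n) : (Fin n → ℂ) →L[ℝ] ℂ :=
  Sum.elim (fun j => ContinuousLinearMap.proj j)
    (fun j => Complex.conjCLE.toContinuousLinearMap.comp (ContinuousLinearMap.proj j)) i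

theorem coordLin_apply (i : Fin n ⊕ Fin n) (z : Fin n → ℂ) : coordLin i z = coordVec z i := by
  rcases i with j | j <;> simp [coordLin]

theorem contDiff_coord (i : Fin n ⊕ Fin n) : ContDiff ℝ ∞ fun z : Fin n → ℂ => coordVec z i := by
  simp only [← coordLin_apply]
  exact (coordLin i).contDiff

theorem wirt_coord [DecidableEq (Fin n ⊕ Fin n)] (i j : Fin n ⊕ Fin n) :
    wirt i (fun z => coordVec z j) = fun _ => if j = i then 1 else 0 := by
  funext z
  simp only [← coordLin_apply]
  rw [wirt_eq, (coordLin j).fderiv, wirtLin_apply, coordLin_apply, coordLin_apply]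
  rcases i with i | i <;> rcases j with j | j <;> by_cases h : j = i <;>
    simp [h] <;> norm_num

theorem taylorSeries_coord (i : Fin n ⊕ Fin n) :
    taylorSeries (fun z => coordVec z i) = MvPowerSeries.X i := by
  classical
  apply MvPowerSeries.pderiv.ext
  · intro j
    rw [pderiv_taylorSeries (contDiff_coord i).contDiffAt, wirt_coord, taylorSeries_const,
      MvPowerSeries.pderiv_X, Pi.single_apply]
    split_ifs <;> simp
  · rw [← MvPowerSeries.coeff_zero_eq_constantCoeff_apply, coeff_zero_taylorSeries,
      MvPowerSeries.constantCoeff_X, ← coordLin_apply, map_zero]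

theorem contDiff_eval (p : MvPolynomial (Fin n ⊕ Fin n) ℂ) :
    ContDiff ℝ ∞ fun z : Fin n → ℂ => MvPolynomial.eval (coordVec z) p := by
  induction p using MvPolynomial.induction_on with
  | C c => simpa using contDiff_const
  | add p q hp hq =>
    simp only [map_add]
    exact hp.add hq
  | mul_X p i hp =>
    simp only [map_mul, MvPolynomial.eval_X]
    exact hp.mul (contDiff_coord i)

theorem smoothAtZero_eval (p : MvPolynomial (Fin n ⊕ Fin n) ℂ) :
    SmoothAtZero fun z : Fin n → ℂ => MvPolynomial.eval (coordVec z) p :=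
  (contDiff_eval p).contDiffAt

/-- This recovers a polynomial in independent variables `(z, w)` from its values on `w = z̄`. -/
theorem taylorSeries_eval (p : MvPolynomial (Fin n ⊕ Fin n) ℂ) :
    taylorSeries (fun z => MvPolynomial.eval (coordVec z) p) = p := by
  induction p using MvPolynomial.induction_on with
  | C c => simpa using taylorSeries_const c
  | add p q hp hq =>
    have := taylorSeries_add (smoothAtZero_eval p) (smoothAtZero_eval q)
    rw [hp, hq] at this
    rw [MvPolynomial.coe_add, ← this]
    congr 1
    funext z
    simp
  | mul_X p i hp =>
    have := taylorSeries_mul (smoothAtZero_eval p) (contDiff_coord i).contDiffAt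
    rw [hp, taylorSeries_coord] at this
    rw [MvPolynomial.coe_mul, MvPolynomial.coe_X, ← this]
    congr 1
    funext z
    simp

end Taylor

/-! ### A smooth function that is `O(‖z‖³)` has no terms of degree below three -/

section Vanishing

/-- With `A = D²f(0)`, the derivative of `f - A(z, z)/2` is `o(‖z‖)`, so the function itself is
`o(‖z‖²)` by the mean value inequality. Since `f` is too, so is the quadratic form of `A`. It then
vanishes, and polarization gives `A = 0`. -/
theorem fderiv_fderiv_eq_zero_of_isBigO {V W : Type*} [NormedAddCommGroup V] [NormedSpace ℝ V]
    [NormedAddCommGroup W] [NormedSpace ℝ W] {f : V → W} (hf : ContDiffAt ℝ 2 f 0)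
    (hO : f =O[𝓝 0] fun z => ‖z‖ ^ 3) : fderiv ℝ (fderiv ℝ f) 0 = 0 := by
  have hO' : f =O[𝓝 0] fun z => ‖z - 0‖ ^ 3 := by simpa using hO
  have hf0 : f 0 = 0 := by
    obtain ⟨c, hc⟩ := hO.bound
    simpa using hc.self_of_nhds
  have hf1 : fderiv ℝ f 0 = 0 := (hO'.hasFDerivAt (by norm_num)).fderiv
  have hd : DifferentiableAt ℝ (fderiv ℝ f) 0 :=
    (hf.fderiv_right (m := 1) (by norm_num)).differentiableAt one_ne_zero
  set A := fderiv ℝ (fderiv ℝ f) 0 with hA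
  have hsymm : ∀ v w, A v w = A w v := fun v w => (hf.isSymmSndFDerivAt (by simp)).eq v w
  obtain ⟨ε, hε, hball⟩ := Metric.eventually_nhds_iff_ball.1 (hf.eventually (by simp))
  have hg : ∀ x ∈ Metric.ball (0 : V) ε, HasFDerivWithinAt (fun z => f z - (2⁻¹ : ℝ) • A z z)
      (fderiv ℝ f x - A x) (Metric.ball 0 ε) x := by
    intro x hx
    have h1 := ((hball x hx).differentiableAt two_ne_zero).hasFDerivAt
    have h2 : HasFDerivAt (fun z => A z z)
        ((A x).comp (ContinuousLinearMap.id ℝ V) + A.flip x) x :=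
      (A.hasFDerivAt (x := x)).clm_apply (hasFDerivAt_id x)
    have h3 := (h1.sub (h2.const_smul (2⁻¹ : ℝ))).hasFDerivWithinAt (s := Metric.ball 0 ε)
    have h4 : A x ∘SL ContinuousLinearMap.id ℝ V + A.flip x = (2 : ℝ) • A x := by
      ext v
      simp [hsymm v x, two_smul]
    rw [h4, smul_smul, inv_mul_cancel₀ two_ne_zero, one_smul] at h3
    exact h3
  have hlo : (fun x => fderiv ℝ f x - A x) =o[𝓝[Metric.ball 0 ε] 0]
      fun x => ‖x - 0‖ ^ 1 := by
    have := hd.hasFDerivAt.isLittleO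
    simp only [hf1, sub_zero, ← hA] at this
    simpa using (this.norm_right).mono nhdsWithin_le_nhds
  have h := (convex_ball (0 : V) ε).isLittleO_pow_succ (Metric.mem_ball_self hε) hg hlo
  rw [nhdsWithin_eq_nhds.2 (Metric.ball_mem_nhds 0 hε)] at h
  simp only [hf0, map_zero, smul_zero, sub_zero] at h
  have hf2 : f =o[𝓝 0] fun z => ‖z‖ ^ 2 :=
    hO.trans_isLittleO ((isLittleO_pow_pow (by norm_num : 2 < 3)).comp_tendsto
      (by simpa using (continuous_norm (E := V)).tendsto 0))
  have hq : (fun z => (2⁻¹ : ℝ) • A z z) =o[𝓝 0] fun z => ‖z‖ ^ 2 := by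
    simpa using hf2.sub h
  have hdiag : ∀ v, A v v = 0 := by
    intro v
    have ht : Tendsto (fun t : ℝ => t • v) (𝓝[≠] 0) (𝓝 0) := by
      have : Tendsto (fun t : ℝ => t • v) (𝓝 0) (𝓝 ((0 : ℝ) • v)) :=
        (continuous_id.smul continuous_const).tendsto 0
      rw [zero_smul] at this
      exact this.mono_left nhdsWithin_le_nhds
    have h1 := hq.comp_tendsto ht
    -- On the line `t • v` both sides scale by `t ^ 2`; dividing leaves a constant that is little-o
    -- of a constant.
    have h2 : (fun _ : ℝ => (2⁻¹ : ℝ) • A v v) =o[𝓝[≠] 0] fun _ : ℝ => ‖v‖ ^ 2 := by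
      rw [isLittleO_iff] at h1 ⊢
      intro c hc
      filter_upwards [h1 hc, self_mem_nhdsWithin] with t ht1 ht0
      have ht2 : 0 < t ^ 2 := sq_pos_of_ne_zero ht0
      simp only [Function.comp_apply, map_smul, _root_.smul_apply, norm_smul,
        mul_pow, Real.norm_eq_abs, sq_abs, abs_mul, abs_pow, abs_norm] at ht1 ⊢
      have hab : |t| * |t| = t ^ 2 := by rw [← sq, sq_abs]
      refine le_of_mul_le_mul_left ?_ ht2
      linear_combination ht1 + (-|2⁻¹| * ‖A v v‖) * hab
    have h3 := isLittleO_const_const_iff.1 h2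
    simpa using h3
  ext v w
  have := hdiag (v + w)
  simp only [map_add, _root_.add_apply, hdiag, hsymm w v, zero_add, add_zero] at this
  rw [← two_smul ℝ] at this
  simpa using this

theorem le_order_taylorSeries_of_isBigO {n : ℕ} {f : (Fin n → ℂ) → ℂ} (hf : SmoothAtZero f)
    (hO : f =O[𝓝 0] fun z => ‖z‖ ^ 3) : ((3 : ℕ) : ℕ∞) ≤ (taylorSeries f).order := by
  have hf2 : ContDiffAt ℝ 2 f 0 := by exact_mod_cast contDiffAt_infty.1 hf 2
  have hO' : f =O[𝓝 0] fun z => ‖z - 0‖ ^ 3 := by simpa using hO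
  have hf0 : f 0 = 0 := by
    obtain ⟨c, hc⟩ := hO.bound
    simpa using hc.self_of_nhds
  have hf1 : fderiv ℝ f 0 = 0 := (hO'.hasFDerivAt (by norm_num)).fderiv
  have hd : DifferentiableAt ℝ (fderiv ℝ f) 0 := hf.fderiv.differentiableAt (by simp)
  apply le_order_of_pderiv (by rw [coeff_zero_taylorSeries, hf0])
  intro i
  rw [pderiv_taylorSeries hf]
  apply le_order_of_pderiv (by rw [coeff_zero_taylorSeries, wirt_eq, hf1, map_zero])
  intro j
  rw [pderiv_taylorSeries (hf.wirt i)]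
  apply le_order_of_pderiv _ (by simp)
  have hw : wirt i f = fun w => wirtLin i (fderiv ℝ f w) := funext (wirt_eq i f)
  have h := ((wirtLin i).hasFDerivAt.comp 0 hd.hasFDerivAt).fderiv
  rw [Function.comp_def, ← hw, fderiv_fderiv_eq_zero_of_isBigO hf2 hO,
    ContinuousLinearMap.comp_zero] at h
  rw [coeff_zero_taylorSeries, wirt_eq, h, map_zero]

end Vanishing

end CRSing

end

noncomputable section

namespace CRSing

open Filter Asymptotics

/-! ### The CR condition in terms of `z̄`-gradients -/

section CR

variable {n : ℕ}

theorem vecDeriv_dzbarVec (f : (Fin n → ℂ) → ℂ) (z : Fin n → ℂ) (j : Fin n) :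
    vecDeriv f z (dzbarVec j) = dzbar j f z := by
  simp only [vecDeriv, dzbarVec, map_add, LinearMap.liftBaseChange_tmul, LinearMap.comp_apply,
    LinearMap.fst_apply, dzbar, smul_eq_mul, ContinuousLinearMap.coe_coe]
  ring

theorem vecDeriv_linearCombination (f : (Fin n → ℂ) → ℂ) (z c : Fin n → ℂ) :
    vecDeriv f z (Fintype.linearCombination ℂ dzbarVec c) = ∑ j, c j * dzbar j f z := by
  simp only [Fintype.linearCombination_apply, map_sum, map_smul, vecDeriv_dzbarVec, smul_eq_mul]

/-- Differentiating the function `z̄_j` along the combination reads off its coefficient `c_j`. -/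
theorem linearCombination_dzbarVec_injective :
    Function.Injective (Fintype.linearCombination ℂ (dzbarVec (n := n))) := by
  classical
  rw [← LinearMap.ker_eq_bot, LinearMap.ker_eq_bot']
  intro c hc
  funext j
  have h := vecDeriv_linearCombination (fun w => coordVec w (Sum.inr j)) 0 c
  have hd : ∀ k, dzbar k (fun w : Fin n → ℂ => coordVec w (Sum.inr j)) 0 = if j = k then 1 else 0 := by
    intro k
    have := congrFun (wirt_coord (Sum.inr k) (Sum.inr j : Fin n ⊕ Fin n)) 0
    simpa [wirt] using this
  rw [hc, map_zero] at h
  simp only [hd] at h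
  simpa using h.symm

theorem dzbar_ofReal {ρ : (Fin n → ℂ) → ℝ} {z : Fin n → ℂ} (hρ : DifferentiableAt ℝ ρ z)
    (j : Fin n) : dzbar j (fun w => (ρ w : ℂ)) z
      = ((fderiv ℝ ρ z (Pi.single j 1) : ℂ)
        + Complex.I * (fderiv ℝ ρ z (Pi.single j Complex.I) : ℂ)) / 2 := by
  have h := (Complex.ofRealCLM.hasFDerivAt.comp z hρ.hasFDerivAt).fderiv
  have h' : (⇑Complex.ofRealCLM ∘ ρ) = fun w => (ρ w : ℂ) := rfl
  rw [h'] at h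
  rw [dzbar, h]
  rfl

/-- Tangent vectors to the graph are annihilated by `ds - dρ`, which gives one direction. For the
other, each `(u, 0)` is the tangent vector `(u, dρ u)` minus `dρ u` times the vertical vector; the
vertical parts add up to `∑ c_j ∂ρ/∂z̄_j`. -/
theorem linearCombination_mem_T01_iff {ρ : (Fin n → ℂ) → ℝ} {z : Fin n → ℂ}
    (hρ : DifferentiableAt ℝ ρ z) (c : Fin n → ℂ) :
    Fintype.linearCombination ℂ dzbarVec c ∈ T01 ρ z
      ↔ ∑ j, c j * dzbar j (fun w => (ρ w : ℂ)) z = 0 := by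
  have hfd : fderiv ℝ (fun w => (w, ρ w)) z
      = (ContinuousLinearMap.id ℝ (Fin n → ℂ)).prod (fderiv ℝ ρ z) :=
    ((hasFDerivAt_id z).prodMk hρ.hasFDerivAt).fderiv
  have hspan : Fintype.linearCombination ℂ dzbarVec c
      ∈ Submodule.span ℂ (Set.range (dzbarVec (n := n))) := by
    rw [← Fintype.range_linearCombination]
    exact ⟨c, rfl⟩
  rw [T01, Submodule.mem_inf, and_iff_left hspan]
  constructor
  · intro h
    let g : (Fin n → ℂ) × ℝ →ₗ[ℝ] ℂ := Complex.ofRealCLM.toLinearMap ∘ₗ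
      (LinearMap.snd ℝ _ ℝ - (fderiv ℝ ρ z).toLinearMap ∘ₗ LinearMap.fst ℝ _ ℝ)
    have hg : ∀ u t, g (u, t) = (t : ℂ) - (fderiv ℝ ρ z u : ℂ) := fun u t => by simp [g]
    have hker : (graphTangent ρ z).baseChange ℂ ≤ LinearMap.ker (LinearMap.liftBaseChange ℂ g) := by
      rw [Submodule.baseChange_eq_span, Submodule.span_le]
      rintro _ ⟨_, ⟨w, rfl⟩, rfl⟩
      rw [SetLike.mem_coe, LinearMap.mem_ker]
      rw [TensorProduct.mk_apply, LinearMap.liftBaseChange_tmul, one_smul, hfd]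
      simp [g]
    have h0 := hker h
    rw [LinearMap.mem_ker, Fintype.linearCombination_apply, map_sum] at h0
    rw [← neg_eq_zero, ← Finset.sum_neg_distrib, ← h0]
    refine Finset.sum_congr rfl fun j _ => ?_
    rw [map_smul, dzbarVec, map_add, LinearMap.liftBaseChange_tmul, LinearMap.liftBaseChange_tmul,
      hg, hg, dzbar_ofReal hρ]
    simp only [smul_eq_mul, Complex.ofReal_zero]
    ring
  · intro h
    have hmem : ∀ (d : ℂ) (u : Fin n → ℂ),
        d ⊗ₜ[ℝ] ((u, fderiv ℝ ρ z u) : (Fin n → ℂ) × ℝ) ∈ (graphTangent ρ z).baseChange ℂ := by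
      intro d u
      apply Submodule.tmul_mem_baseChange_of_mem
      refine ⟨u, ?_⟩
      rw [hfd]
      rfl
    have hsplit : ∀ (d : ℂ) (u : Fin n → ℂ),
        d ⊗ₜ[ℝ] ((u, 0) : (Fin n → ℂ) × ℝ) = d ⊗ₜ[ℝ] ((u, fderiv ℝ ρ z u) : (Fin n → ℂ) × ℝ)
          - ((fderiv ℝ ρ z u : ℂ) * d) ⊗ₜ[ℝ] ((0, 1) : (Fin n → ℂ) × ℝ) := by
      intro d u
      have h1 : ((u, 0) : (Fin n → ℂ) × ℝ)
          = (u, fderiv ℝ ρ z u) - (fderiv ℝ ρ z u) • ((0, 1) : (Fin n → ℂ) × ℝ) := by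
        ext <;> simp
      rw [h1, TensorProduct.tmul_sub, ← TensorProduct.smul_tmul, Complex.real_smul]
    have hv : Fintype.linearCombination ℂ dzbarVec c
        = (∑ j, c j • ((1 / 2 : ℂ) ⊗ₜ[ℝ] ((Pi.single j 1, fderiv ℝ ρ z (Pi.single j 1)) :
              (Fin n → ℂ) × ℝ)
            + (Complex.I / 2) ⊗ₜ[ℝ] ((Pi.single j Complex.I,
              fderiv ℝ ρ z (Pi.single j Complex.I)) : (Fin n → ℂ) × ℝ)))
          - (∑ j, c j * dzbar j (fun w => (ρ w : ℂ)) z) ⊗ₜ[ℝ] ((0, 1) : (Fin n → ℂ) × ℝ) := by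
      rw [TensorProduct.sum_tmul, ← Finset.sum_sub_distrib, Fintype.linearCombination_apply]
      refine Finset.sum_congr rfl fun j _ => ?_
      rw [dzbarVec, hsplit, hsplit, dzbar_ofReal hρ, ← smul_eq_mul (c j),
        ← TensorProduct.smul_tmul', ← smul_sub]
      congr 1
      rw [add_div, TensorProduct.add_tmul, mul_one_div, mul_div_assoc', mul_comm Complex.I]
      abel
    rw [hv, h, TensorProduct.zero_tmul, sub_zero]
    exact Submodule.sum_mem _ fun j _ => Submodule.smul_mem _ _ (add_mem (hmem _ _) (hmem _ _))

/-- Where `∂̄ρ ≠ 0` the graph of `ρ` has CR dimension `n - 1`. -/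
theorem isCRPoint_of_dzbar_ne_zero {ρ : (Fin n → ℂ) → ℝ} {z : Fin n → ℂ}
    (hρ : DifferentiableAt ℝ ρ z) {j : Fin n} (hj : dzbar j (fun w => (ρ w : ℂ)) z ≠ 0) :
    IsCRPoint ρ z := by
  classical
  let ψ : Module.Dual ℂ (Fin n → ℂ) :=
    Fintype.linearCombination ℂ fun k => dzbar k (fun w => (ρ w : ℂ)) z
  have hψ : ∀ c, ψ c = ∑ k, c k * dzbar k (fun w => (ρ w : ℂ)) z := fun c => by
    simp [ψ, Fintype.linearCombination_apply]
  have hT : T01 ρ z = (LinearMap.ker ψ).map (Fintype.linearCombination ℂ dzbarVec) := by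
    ext v
    rw [Submodule.mem_map]
    constructor
    · intro hv
      have hv' := (Submodule.mem_inf.1 hv).2
      rw [← Fintype.range_linearCombination] at hv'
      obtain ⟨c, rfl⟩ := hv'
      exact ⟨c, by rw [LinearMap.mem_ker, hψ, ← linearCombination_mem_T01_iff hρ]; exact hv, rfl⟩
    · rintro ⟨c, hc, rfl⟩
      rwa [linearCombination_mem_T01_iff hρ, ← hψ]
  have hψ0 : ψ ≠ 0 := by
    intro h
    apply hj
    have := hψ (Pi.single j 1)
    rw [h] at this
    simpa [Pi.single_apply] using this.symm
  rw [IsCRPoint, hT, ← (Submodule.equivMapOfInjective _ linearCombination_dzbarVec_injective _).finrank_eq,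
    Module.Dual.finrank_ker_add_one_of_ne_zero hψ0]
  simp

/-- The `z̄`-gradient of a CR function is parallel to that of the defining function. -/
theorem IsCRFunction.dzbar_mul_eq {ρ : (Fin n → ℂ) → ℝ} {U : Set (Fin n → ℂ)}
    {f : (Fin n → ℂ) → ℂ} (hf : IsCRFunction ρ U f) {z : Fin n → ℂ} (hz : z ∈ U)
    (hρ : DifferentiableAt ℝ ρ z) (i l : Fin n) :
    dzbar i (fun w => (ρ w : ℂ)) z * dzbar l f z
      = dzbar l (fun w => (ρ w : ℂ)) z * dzbar i f z := by
  classical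
  by_cases h : ∀ j, dzbar j (fun w => (ρ w : ℂ)) z = 0
  · rw [h i, h l, zero_mul, zero_mul]
  push Not at h
  obtain ⟨j, hj⟩ := h
  -- The test vector is `ρ_i ∂/∂z̄_l - ρ_l ∂/∂z̄_i`, which annihilates `ρ` and turns the CR equation
  -- into the desired relation.
  have hsum : ∀ g : Fin n → ℂ, ∑ k, (Pi.single l (dzbar i (fun w => (ρ w : ℂ)) z)
      - Pi.single i (dzbar l (fun w => (ρ w : ℂ)) z) : Fin n → ℂ) k * g k
      = dzbar i (fun w => (ρ w : ℂ)) z * g l - dzbar l (fun w => (ρ w : ℂ)) z * g i := by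
    intro g
    simp [sub_mul, Finset.sum_sub_distrib, Pi.single_apply]
  have hv := hf z hz (isCRPoint_of_dzbar_ne_zero hρ hj) _
    ((linearCombination_mem_T01_iff hρ _).2 ((hsum _).trans (by ring)))
  rw [vecDeriv_linearCombination, hsum] at hv
  exact sub_eq_zero.1 hv

/-- The Taylor series of a smooth CR function and of the defining function have parallel
`z̄`-gradients. -/
theorem IsCRFunction.isParallel {ρ : (Fin n → ℂ) → ℝ} {U : Set (Fin n → ℂ)}
    {f : (Fin n → ℂ) → ℂ} (hf : IsCRFunction ρ U f) (hU : U ∈ 𝓝 0)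
    (hρ : SmoothAtZero fun z => (ρ z : ℂ)) (hρU : ∀ z ∈ U, DifferentiableAt ℝ ρ z)
    (hfs : SmoothAtZero f) :
    IsParallel (taylorSeries fun z => (ρ z : ℂ)) (taylorSeries f) := by
  intro i l
  rw [pderiv_taylorSeries hρ, pderiv_taylorSeries hρ, pderiv_taylorSeries hfs,
    pderiv_taylorSeries hfs, ← taylorSeries_mul (hρ.wirt _) (hfs.wirt _),
    ← taylorSeries_mul (hρ.wirt _) (hfs.wirt _)]
  apply taylorSeries_congr
  filter_upwards [hU] with z hz
  exact hf.dzbar_mul_eq hz (hρU z hz) i l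

end CR

/-! ### The quadric as a polynomial in `z` and `w` -/

section QuadPoly

open MvPolynomial (aeval pderiv X C monomial)

variable {n : ℕ}

/-- The polynomial `Q(z, w)` with `quadForm a b B z = Q(z, z̄)`. -/
def quadPoly (a b : ℕ) (B : LinearMap.BilinForm ℂ (Fin n → ℂ)) :
    MvPolynomial (Fin n ⊕ Fin n) ℂ :=
  ∑ j : Fin n with j.val < a, X (Sum.inl j) * X (Sum.inr j)
    - ∑ j : Fin n with a ≤ j.val ∧ j.val < a + b, X (Sum.inl j) * X (Sum.inr j)
    + (∑ j, ∑ k, C (B (Pi.single j 1) (Pi.single k 1)) * (X (Sum.inl j) * X (Sum.inl k))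
      + ∑ j, ∑ k, C (conj (B (Pi.single j 1) (Pi.single k 1))) * (X (Sum.inr j) * X (Sum.inr k)))

theorem eval_quadPoly (a b : ℕ) (B : LinearMap.BilinForm ℂ (Fin n → ℂ)) (z : Fin n → ℂ) :
    MvPolynomial.eval (coordVec z) (quadPoly a b B) = ((quadForm a b B z : ℝ) : ℂ) := by
  have hB : B z z = ∑ j, ∑ k, B (Pi.single j 1) (Pi.single k 1) * (z j * z k) := by
    conv_lhs => rw [pi_eq_sum_univ' z]
    simp only [map_sum, map_smul, LinearMap.sum_apply, LinearMap.smul_apply, smul_eq_mul,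
      Finset.mul_sum]
    rw [Finset.sum_comm]
    refine Finset.sum_congr rfl fun j _ => Finset.sum_congr rfl fun k _ => ?_
    ring
  have hre : ((B z z + conj (B z z)).re : ℂ) = B z z + conj (B z z) := by
    rw [Complex.add_conj]
    simp
  change _ = ((quadFun a b B z : ℝ) : ℂ)
  rw [quadFun, Complex.ofReal_add, hre, hB]
  simp only [quadPoly, map_add, map_sub, map_sum, map_mul, MvPolynomial.eval_X,
    MvPolynomial.eval_C, Sum.elim_inl, Sum.elim_inr, Complex.ofReal_sub, Complex.ofReal_sum,
    Complex.ofReal_pow, Complex.mul_conj']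

theorem isHomogeneous_quadPoly (a b : ℕ) (B : LinearMap.BilinForm ℂ (Fin n → ℂ)) :
    (quadPoly a b B).IsHomogeneous 2 := by
  have hXX : ∀ i j : Fin n ⊕ Fin n,
      (X i * X j : MvPolynomial (Fin n ⊕ Fin n) ℂ).IsHomogeneous 2 := fun i j =>
    (MvPolynomial.isHomogeneous_X _ i).mul (MvPolynomial.isHomogeneous_X _ j)
  refine ((MvPolynomial.IsHomogeneous.sum _ _ _ fun j _ => hXX _ _).sub
    (MvPolynomial.IsHomogeneous.sum _ _ _ fun j _ => hXX _ _)).add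
    (MvPolynomial.IsHomogeneous.add ?_ ?_) <;>
  exact MvPolynomial.IsHomogeneous.sum _ _ _ fun j _ =>
    MvPolynomial.IsHomogeneous.sum _ _ _ fun k _ => (hXX _ _).C_mul _

/-- Setting `w = 0` and `z = e_i` extracts the coefficient of `z_i` in `∂Q/∂w_j`; the conjugate of
`B` contributes only terms in `w`, and `B` itself none. -/
theorem eval_pderiv_quadPoly {a : ℕ} (b : ℕ) (B : LinearMap.BilinForm ℂ (Fin n → ℂ)) {j : Fin n}
    (hj : j.val < a) (i : Fin n) :
    MvPolynomial.eval (Sum.elim (Pi.single i 1) 0) (pderiv (Sum.inr j) (quadPoly a b B))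
      = if j = i then 1 else 0 := by
  simp [quadPoly, Derivation.leibniz, Pi.single_apply, apply_ite (MvPolynomial.eval _), hj,
    not_le.2 hj]

theorem quadPoly_prime_and_not_dvd {a : ℕ} (b : ℕ) (B : LinearMap.BilinForm ℂ (Fin n → ℂ))
    {j k : Fin n} (hj : j.val < a) (hk : k.val < a) (hjk : j ≠ k) :
    Prime (pderiv (Sum.inr j) (quadPoly a b B)) ∧
      ¬ pderiv (Sum.inr j) (quadPoly a b B) ∣ pderiv (Sum.inr k) (quadPoly a b B) := by
  have hhom : ∀ i, (pderiv (Sum.inr i) (quadPoly a b B)).IsHomogeneous 1 := fun i =>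
    (isHomogeneous_quadPoly a b B).pderiv
  refine ⟨prime_of_isHomogeneous_one (hhom j) fun h => ?_, fun h => ?_⟩
  · have := eval_pderiv_quadPoly b B hj j
    simp [h] at this
  · obtain ⟨c, hc⟩ := exists_C_mul_eq_of_dvd (hhom j) (hhom k) h
    have h1 := eval_pderiv_quadPoly b B hk j
    have h2 := eval_pderiv_quadPoly b B hk k
    rw [hc, map_mul, eval_pderiv_quadPoly b B hj] at h1 h2
    simp [hjk] at h2

end QuadPoly

end CRSing

end

/-! ### The quadric and its perturbations -/

open CRSing in
theorem proposition6p2 (n a b : ℕ) (hn : 2 ≤ n) (ha : 2 ≤ a) (hab : a + b ≤ n)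
    (B : LinearMap.BilinForm ℂ (Fin n → ℂ))
    (hQ : CRSing.QuadNondegenerate (CRSing.quadForm a b B)) :
    -- polynomial CR functions on the quadric
    (∀ f : MvPolynomial (Fin n ⊕ Fin n) ℂ,
      CRSing.IsCRFunction (CRSing.quadForm a b B) Set.univ
        (fun z => MvPolynomial.eval (Sum.elim z (fun j => conj (z j))) f) →
      ∃ F : MvPolynomial (Fin n ⊕ Unit) ℂ,
        (∀ z : Fin n → ℂ,
          MvPolynomial.eval (Sum.elim z (fun j => conj (z j))) f
            = MvPolynomial.eval
                (Sum.elim z (fun _ => ((CRSing.quadForm a b B z : ℝ) : ℂ))) F) ∧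
        ∀ d : ℕ, f.IsHomogeneous d →
          F.IsWeightedHomogeneous (Sum.elim (fun _ => 1) (fun _ => 2) : Fin n ⊕ Unit → ℕ) d) ∧
    -- smooth CR functions on `M : s = Q + E`, with `E = O(3)`
    (∀ (U : Set (Fin n → ℂ)) (E : (Fin n → ℂ) → ℝ) (f : (Fin n → ℂ) → ℂ),
      IsOpen U → (0 : Fin n → ℂ) ∈ U →
      ContDiffOn ℝ ∞ E U → E =O[𝓝 0] (fun z => ‖z‖ ^ 3) →
      ContDiffOn ℝ ∞ f U →
      CRSing.IsCRFunction (fun z => CRSing.quadForm a b B z + E z) U f →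
      ∃ F : MvPowerSeries (Fin n ⊕ Unit) ℂ,
        CRSing.FormallyExtends (fun z => CRSing.quadForm a b B z + E z) f F) := by
  obtain ⟨hp, hnd⟩ := quadPoly_prime_and_not_dvd (a := a) b B (j := ⟨0, by omega⟩)
    (k := ⟨1, by omega⟩) (by omega : 0 < a) (by omega : 1 < a) (by simp)
  have hhom := isHomogeneous_quadPoly a b B
  have hQT : taylorSeries (fun z => ((quadForm a b B z : ℝ) : ℂ)) = quadPoly a b B := by
    rw [← taylorSeries_eval]
    simp only [eval_quadPoly]
  have hQS : SmoothAtZero (fun z => ((quadForm a b B z : ℝ) : ℂ)) := by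
    simpa only [eval_quadPoly] using smoothAtZero_eval (quadPoly a b B)
  have hQd : Differentiable ℝ (quadForm a b B) := by
    have h : ⇑(quadForm a b B)
        = fun z => (MvPolynomial.eval (coordVec z) (quadPoly a b B)).re := by
      funext z
      rw [eval_quadPoly, Complex.ofReal_re]
    rw [h]
    exact Complex.reCLM.differentiable.comp ((contDiff_eval _).differentiable (by simp))
  refine ⟨fun f hf => ?_, fun U E f hU h0 hE hEO hfs hf => ?_⟩
  · have hpar := hf.isParallel Filter.univ_mem hQS (fun z _ => hQd z) (smoothAtZero_eval f)
    rw [hQT, taylorSeries_eval] at hpar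
    have hpar' : ∀ i l : Fin n, MvPolynomial.pderiv (Sum.inr i) (quadPoly a b B)
        * MvPolynomial.pderiv (Sum.inr l) f = MvPolynomial.pderiv (Sum.inr l) (quadPoly a b B)
          * MvPolynomial.pderiv (Sum.inr i) f := by
      intro i l
      have := hpar i l
      simp only [MvPowerSeries.pderiv_coe, ← MvPolynomial.coe_mul] at this
      exact MvPolynomial.coe_injective _ _ this
    have hex := exists_aeval_eq_of_pderiv_parallel _ _ _ hp hnd f hpar'
    have heval : ∀ (F : MvPolynomial (Fin n ⊕ Unit) ℂ) (z : Fin n → ℂ),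
        MvPolynomial.eval (coordVec z) (MvPolynomial.aeval
            (Sum.elim (fun i => MvPolynomial.X (Sum.inl i)) fun _ => quadPoly a b B) F)
          = MvPolynomial.eval (Sum.elim z (fun _ => ((quadForm a b B z : ℝ) : ℂ))) F := by
      intro F z
      induction F using MvPolynomial.induction_on with
      | C c => simp
      | add p q hp hq => rw [map_add, map_add, hp, hq, map_add]
      | mul_X p i hp =>
        rw [map_mul, map_mul, hp, map_mul, MvPolynomial.aeval_X, MvPolynomial.eval_X]
        rcases i with i | i <;> simp [eval_quadPoly]
    -- One `F` must serve every degree `d` in which `f` is homogeneous. The zero polynomial has all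
    -- degrees, so it gets `F = 0`; a nonzero `f` has at most one.
    by_cases hf0 : f = 0
    · exact ⟨0, by simp [hf0], fun d _ => MvPolynomial.isWeightedHomogeneous_zero _ _ _⟩
    by_cases hd : ∃ d, f.IsHomogeneous d
    · obtain ⟨d, hd⟩ := hd
      obtain ⟨F, hFd, hF⟩ := exists_isWeightedHomogeneous_aeval_eq hhom hex hd
      refine ⟨F, fun z => ?_, fun d' hd' => ?_⟩
      · rw [← heval, hF]
      · rw [hd'.inj_right hd hf0]
        exact hFd
    · obtain ⟨F, hF⟩ := hex
      exact ⟨F, fun z => by rw [← heval, hF], fun d hd' => absurd ⟨d, hd'⟩ hd⟩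
  · have hU0 : U ∈ 𝓝 0 := hU.mem_nhds h0
    have hES : SmoothAtZero fun z => (E z : ℂ) :=
      Complex.ofRealCLM.contDiff.contDiffAt.comp 0 (hE.contDiffAt hU0)
    have hfS : SmoothAtZero f := hfs.contDiffAt hU0
    have hsum : (fun z => ((quadForm a b B z + E z : ℝ) : ℂ))
        = (fun z => ((quadForm a b B z : ℝ) : ℂ)) + fun z => (E z : ℂ) := by
      funext z
      simp
    have hρS : SmoothAtZero fun z => ((quadForm a b B z + E z : ℝ) : ℂ) := by
      rw [hsum]
      exact hQS.add hES
    have hEO' : (fun z => (E z : ℂ)) =O[𝓝 0] fun z => ‖z‖ ^ 3 := by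
      rw [← Asymptotics.isBigO_norm_left] at hEO ⊢
      simpa using hEO
    have hord : ((3 : ℕ) : ℕ∞) ≤ (taylorSeries (fun z => ((quadForm a b B z + E z : ℝ) : ℂ))
        - (quadPoly a b B : MvPowerSeries (Fin n ⊕ Fin n) ℂ)).order := by
      rw [hsum, taylorSeries_add hQS hES, hQT, add_sub_cancel_left]
      exact le_order_taylorSeries_of_isBigO hES hEO'
    have hpar := hf.isParallel hU0 hρS (fun z hz => (hQd z).add
      ((hE.contDiffAt (hU.mem_nhds hz)).differentiableAt (by simp))) hfS
    obtain ⟨hsub, F, hF⟩ := exists_subst_eq_of_isParallel hhom hp hnd hord hpar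
    exact ⟨F, hsub, hF⟩
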